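/- Setting. An instance consists of integers $n\ge 1$ and $d$, variables $X=\{X_1,\dots,X_n\}$, two sets $S,T\subseteq X$ with $S\cup T=X$, and for every variable an interval domain $D(X_i)=\{lb_i,lb_i+1,\dots,ub_i\}$ with $1\le lb_i\le ub_i\le d$. The constraint $\mathrm{OverlappingAllDiff}(X,S,T)$ holds for an assignment iff the variables in $S$ take pairwise different values and the variables in $T$ take pairwise different values. For arbitrary (not necessarily interval) finite domains $E$, a bound support in $E$ is an assignment that satisfies the constraint and gives each $X_i$ a value between $\min E(X_i)$ and $\max E(X_i)$; the constraint is bound consistent on $E$ iff all $E(X_i)$ are nonempty and, for each $i$ and each $v\in\{\min E(X_i),\max E(X_i)\}$, there is a bound support in $E$ with $X_i=v$. Enforcing bound consistency (BC) on $D$ means to compute the largest $E\subseteq D$ (inclusion for each variable) on which the constraint is bound consistent, or to report that there is no such $E$. Theorem. BC on $\mathrm{OverlappingAllDiff}(X,S,T)$ can be enforced in $O(nd^3)$ time. That is, there are a single program for a random access machine (constants, copying, addition, truncated subtraction, multiplication, indirect load and store, comparison jumps; one time unit per instruction) and a constant $c$ such that on every instance, given by $n$, $d$, the bounds $lb_i,ub_i$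 and the membership bits of $S$ and $T$, the program halts after at most $c\,nd^3$ steps with the result of enforcing BC on $D$ (the largest $E$ consists of intervals and is returned by its bounds), and all words stored during the run are at most $(n+d)^c$, i.e. have $O(\log(n+d))$ bits. -/

import Mathlib

/-! Constraints over variables `X` with natural-number values, bound consistency. -/

/-- A constraint on the variables `X`: the set of assignments it allows. -/
abbrev CSPConstraint (X : Type*) := (X → ℕ) → Prop

/-- A domain of values `D x` for every variable `x`, ordered by pointwise inclusion. -/
abbrev CSPDomain (X : Type*) := X → Finset ℕ

/-- The variables in `S` take pairwise different values. -/
def AllDifferentOn {X : Type*} (S : Finset X) : CSPConstraint X :=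
  fun a => ∀ x ∈ S, ∀ y ∈ S, x ≠ y → a x ≠ a y

/-- The conjunction of the two constraints `AllDifferent S` and `AllDifferent T`. -/
def OverlappingAllDiff {X : Type*} (S T : Finset X) : CSPConstraint X :=
  fun a => AllDifferentOn S a ∧ AllDifferentOn T a

/-- `a` is an allowed assignment in which each variable lies between the minimum and the maximum
of its domain. -/
def IsBoundSupport {X : Type*} (C : CSPConstraint X) (D : CSPDomain X) (a : X → ℕ) : Prop :=
  C a ∧ ∀ x, ∃ l ∈ D x, ∃ u ∈ D x, l ≤ a x ∧ a x ≤ u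

/-- All domains are nonempty, and whenever a variable is assigned the minimum or the maximum of its
domain, this extends to a bound support. -/
def BoundConsistent {X : Type*} (C : CSPConstraint X) (D : CSPDomain X) : Prop :=
  (∀ x, (D x).Nonempty) ∧
    ∀ x v, (IsLeast (D x : Set ℕ) v ∨ IsGreatest (D x : Set ℕ) v) →
      ∃ a, IsBoundSupport C D a ∧ a x = v

/-- The bound consistent domains that are contained in `D`. -/
def bcSubdomains {X : Type*} (C : CSPConstraint X) (D : CSPDomain X) : Set (CSPDomain X) :=
  {E | E ≤ D ∧ BoundConsistent C E}

/-! A random access machine with finitely many program-addressed registers, a memory with indirect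
addressing, and unit cost per instruction. -/

namespace WordRAM

/-- Instructions; the arguments are register names, except for the number `k` and the program line
`p`. -/
inductive Instr where
  | const (r k : ℕ)
  | copy (r a : ℕ)
  | add (r a b : ℕ)
  | sub (r a b : ℕ)
  | mul (r a b : ℕ)
  | load (r a : ℕ)
  | store (a b : ℕ)
  | jumpLT (a b p : ℕ)

/-- A program is a finite list of instructions. -/
abbrev Program := List Instr

/-- A configuration: current program line, registers, memory. -/
structure Config where
  pc : ℕ
  reg : ℕ → ℕ
  mem : ℕ → ℕ

/-- Write `v` into register `r` and go on to the next line. -/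
def Config.setReg (c : Config) (r v : ℕ) : Config :=
  ⟨c.pc + 1, Function.update c.reg r v, c.mem⟩

/-- The effect of one instruction (`sub` is truncated at `0`). -/
def Instr.exec : Instr → Config → Config
  | .const r k, c => c.setReg r k
  | .copy r a, c => c.setReg r (c.reg a)
  | .add r a b, c => c.setReg r (c.reg a + c.reg b)
  | .sub r a b, c => c.setReg r (c.reg a - c.reg b)
  | .mul r a b, c => c.setReg r (c.reg a * c.reg b)
  | .load r a, c => c.setReg r (c.mem (c.reg a))
  | .store a b, c => ⟨c.pc + 1, c.reg, Function.update c.mem (c.reg a) (c.reg b)⟩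
  | .jumpLT a b p, c => ⟨if c.reg a < c.reg b then p else c.pc + 1, c.reg, c.mem⟩

/-- The machine has halted when the program counter is not the number of a program line. -/
def Halted (P : Program) (c : Config) : Prop := P.length ≤ c.pc

/-- One step of `P`; a halted machine stays as it is. -/
def step (P : Program) (c : Config) : Config :=
  match P[c.pc]? with
  | some i => i.exec c
  | none => c

/-- The configuration after `t` steps. -/
def run (P : Program) (t : ℕ) (c : Config) : Config := (step P)^[t] c

/-- All words held in registers and memory are at most `B`. -/
def Config.WordsLE (c : Config) (B : ℕ) : Prop := ∀ k, c.reg k ≤ B ∧ c.mem k ≤ B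

end WordRAM

/-- The input in memory: cells `0` and `1` hold `n` and `d`; for the variable `i`, the cells
`4 * i + 2, …, 4 * i + 5` hold its lower bound, its upper bound, and its membership bits for
`S` and `T`; all other cells hold `0`. -/
def oadInputMemory {n : ℕ} (d : ℕ) (S T : Finset (Fin n)) (lb ub : Fin n → ℕ) (k : ℕ) : ℕ :=
  if k = 0 then n
  else if k = 1 then d
  else if h : (k - 2) / 4 < n then
    if (k - 2) % 4 = 0 then lb ⟨(k - 2) / 4, h⟩
    else if (k - 2) % 4 = 1 then ub ⟨(k - 2) / 4, h⟩
    else if (k - 2) % 4 = 2 then (if ⟨(k - 2) / 4, h⟩ ∈ S then 1 else 0)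
    else (if ⟨(k - 2) / 4, h⟩ ∈ T then 1 else 0)
  else 0

/-- The initial configuration: first program line, registers `0`, the input in memory. -/
def oadInput {n : ℕ} (d : ℕ) (S T : Finset (Fin n)) (lb ub : Fin n → ℕ) : WordRAM.Config :=
  ⟨0, fun _ => 0, oadInputMemory d S T lb ub⟩

/-- The domains read off from the bounds stored in the memory of `c`. -/
def oadOutputDomain (n : ℕ) (c : WordRAM.Config) : CSPDomain (Fin n) :=
  fun i => Finset.Icc (c.mem (4 * (i : ℕ) + 2)) (c.mem (4 * (i : ℕ) + 3))

/-- `c` holds the result of enforcing bound consistency of `C` on the domain `D`: either register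
`0` holds `1` and the stored bounds describe the largest bound consistent domain contained in `D`,
or register `0` holds `0` and there is no bound consistent domain contained in `D`. -/
def HoldsBCResult {n : ℕ} (C : CSPConstraint (Fin n)) (D : CSPDomain (Fin n))
    (c : WordRAM.Config) : Prop :=
  (c.reg 0 = 1 ∧ IsGreatest (bcSubdomains C D) (oadOutputDomain n c)) ∨
    (c.reg 0 = 0 ∧ bcSubdomains C D = ∅)

/-! Bound supports see a domain only through its minimum and maximum. Hence the largest bound
consistent subdomain gives each variable the interval from its least to its greatest value over all
solutions within the given bounds, and there is none if no solution exists
(`isGreatest_bcSubdomains`, `bcSubdomains_eq_empty`). The task is to compute these extreme values.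

Solvability is expressed by difference constraints. Given a solution, let z(t) be the number of
variables of S ∩ T with value at most t. For p ≤ q, z(q) - z(p) is at least the number of variables
of S ∩ T whose interval lies in (p, q]. For q ≤ p, the variables of S use distinct values in (q, p],
so z(p) - z(q) plus the number of variables of S \ T confined to (q, p] is at most p - q; likewise
for T. Conversely, an integral z satisfying these inequalities grows by 0 or 1 at each step. Reserve
the values at which it jumps for S ∩ T and the remaining ones for S \ T and T \ S, which may share
values with each other. The inequalities then yield Hall's condition for three independent interval
matching problems, and for intervals it is enough to check Hall's condition on intervals of values
(`OadSolution.exists_diffSystem`, `DiffSystem.exists_solution`).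

To find the least value of a variable, its upper bound is lowered by one until the system becomes
unsolvable. Lowering only raises weights, so labels lying below every solution with z(0) = 0 stay
below (`BelowSolutions.mono`) and are raised further instead of being recomputed; a label z(p) > p
refutes solvability. Labels never exceed d + n. Thus for one variable all lowerings together cause
O(d(n + d)) relaxations, including one extra visit of each node per lowering, and a relaxation with
its scan costs O(d). Each lowering changes only the O(d) weights at one node, recomputed in O(n)
each; the initial table costs O(nd²). Since n > 2d excludes solutions and is tested at the start, a
variable costs O(d³). Greatest values are obtained by the reflection t ↦ d + 1 - t.

The program is written in a small structured language whose semantics counts machine steps and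
enforces the word bound; `Cmd.Exec.reaches` transfers time, bound and result to the compiled code.
-/

namespace WordRAM

/-! ### A structured language and the compilation of its expressions -/

/-- Arithmetic expressions over variables `V` and the memory. -/
inductive Arith (V : Type) where
  | lit (k : ℕ)
  | var (x : V)
  | add (a b : Arith V)
  | sub (a b : Arith V)
  | mul (a b : Arith V)
  | load (a : Arith V)

/-- Structured programs; conditions are comparisons `a < b`. -/
inductive Cmd (V : Type) where
  | skip
  | assign (x : V) (e : Arith V)
  | store (a e : Arith V)
  | seq (c₁ c₂ : Cmd V)
  | ite (a b : Arith V) (c₁ c₂ : Cmd V)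
  | loop (a b : Arith V) (c : Cmd V)

/-- Values of the variables, memory, and the time elapsed. -/
structure St (V : Type) where
  var : V → ℕ
  mem : ℕ → ℕ
  time : ℕ

namespace Arith

variable {V : Type}

/-- The value of an expression. -/
@[simp] def val (f : V → ℕ) (m : ℕ → ℕ) : Arith V → ℕ
  | lit k => k
  | var x => f x
  | add a b => a.val f m + b.val f m
  | sub a b => a.val f m - b.val f m
  | mul a b => a.val f m * b.val f m
  | load a => m (a.val f m)

/-- No subexpression exceeds the word bound `B`, provided that the state does not. -/
@[simp] def ok (B : ℕ) (f : V → ℕ) (m : ℕ → ℕ) : Arith V → Prop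
  | lit k => k ≤ B
  | var _ => True
  | add a b => a.ok B f m ∧ b.ok B f m ∧ a.val f m + b.val f m ≤ B
  | sub a b => a.ok B f m ∧ b.ok B f m
  | mul a b => a.ok B f m ∧ b.ok B f m ∧ a.val f m * b.val f m ≤ B
  | load a => a.ok B f m

/-- The number of instructions used to evaluate an expression. -/
@[simp] def cost : Arith V → ℕ
  | lit _ => 1
  | var _ => 1
  | add a b => a.cost + b.cost + 1
  | sub a b => a.cost + b.cost + 1
  | mul a b => a.cost + b.cost + 1
  | load a => a.cost + 1

/-- Code that puts the value into register `2 * k + 1`, using the registers `2 * j + 1` for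
`k ≤ j`. The variable `x` is held in register `2 * ρ x`. -/
def code (ρ : V → ℕ) : Arith V → ℕ → Program
  | lit m, k => [.const (2 * k + 1) m]
  | var x, k => [.copy (2 * k + 1) (2 * ρ x)]
  | add a b, k => a.code ρ k ++ (b.code ρ (k + 1) ++
      [.add (2 * k + 1) (2 * k + 1) (2 * (k + 1) + 1)])
  | sub a b, k => a.code ρ k ++ (b.code ρ (k + 1) ++
      [.sub (2 * k + 1) (2 * k + 1) (2 * (k + 1) + 1)])
  | mul a b, k => a.code ρ k ++ (b.code ρ (k + 1) ++
      [.mul (2 * k + 1) (2 * k + 1) (2 * (k + 1) + 1)])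
  | load a, k => a.code ρ k ++ [.load (2 * k + 1) (2 * k + 1)]

@[simp] theorem length_code (ρ : V → ℕ) (e : Arith V) (k : ℕ) : (e.code ρ k).length = e.cost := by
  induction e generalizing k <;> simp_all [code] <;> omega

theorem val_le {B : ℕ} {f : V → ℕ} {m : ℕ → ℕ} (hf : ∀ x, f x ≤ B) (hm : ∀ k, m k ≤ B)
    (e : Arith V) (h : e.ok B f m) : e.val f m ≤ B := by
  induction e with
  | lit k => exact h
  | var x => exact hf x
  | add a b _ _ => exact h.2.2
  | sub a b iha _ => exact (Nat.sub_le _ _).trans (iha h.1)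
  | mul a b _ _ => exact h.2.2
  | load a _ => exact hm _

end Arith

/-- The program `P` contains `Q` from line `k` on. -/
def CodeAt (P : Program) (k : ℕ) (Q : Program) : Prop := ∀ i < Q.length, P[k + i]? = Q[i]?

theorem codeAt_append {P Q R : Program} {k : ℕ} :
    CodeAt P k (Q ++ R) ↔ CodeAt P k Q ∧ CodeAt P (k + Q.length) R := by
  constructor
  · intro h
    refine ⟨fun i hi => ?_, fun i hi => ?_⟩
    · rw [h i (by simp; omega), List.getElem?_append_left hi]
    · have := h (Q.length + i) (by simp; omega)
      rw [List.getElem?_append_right (by omega)] at this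
      simpa [add_assoc] using this
  · rintro ⟨h₁, h₂⟩ i hi
    rcases lt_or_ge i Q.length with h | h
    · rw [h₁ i h, List.getElem?_append_left h]
    · rw [List.getElem?_append_right h, ← h₂ (i - Q.length) (by simp at hi; omega)]
      congr 1
      omega

theorem codeAt_cons {P Q : Program} {k : ℕ} {i : Instr} :
    CodeAt P k (i :: Q) ↔ P[k]? = some i ∧ CodeAt P (k + 1) Q := by
  constructor
  · intro h
    refine ⟨by simpa using h 0 (by simp), fun j hj => ?_⟩
    have := h (j + 1) (by simp; omega)
    rw [show k + 1 + j = k + (j + 1) by omega, this]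
    simp
  · rintro ⟨h₁, h₂⟩ j hj
    cases j with
    | zero => simpa using h₁
    | succ j =>
      rw [show k + (j + 1) = k + 1 + j by omega, h₂ j (by simpa using hj)]
      simp

/-- `c'` is reached from `c` in `t` steps, with all words bounded by `B` on the way. -/
def Reaches (P : Program) (B : ℕ) (c c' : Config) (t : ℕ) : Prop :=
  run P t c = c' ∧ ∀ s ≤ t, (run P s c).WordsLE B

theorem Reaches.refl {P : Program} {B : ℕ} {c : Config} (h : c.WordsLE B) :
    Reaches P B c c 0 := by
  refine ⟨rfl, fun s hs => ?_⟩
  obtain rfl : s = 0 := by omega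
  exact h

theorem run_add (P : Program) (s t : ℕ) (c : Config) : run P (s + t) c = run P t (run P s c) := by
  rw [run, add_comm, Function.iterate_add_apply]; rfl

theorem Reaches.trans {P : Program} {B s t : ℕ} {c c' c'' : Config} (h : Reaches P B c c' s)
    (h' : Reaches P B c' c'' t) : Reaches P B c c'' (s + t) := by
  refine ⟨by rw [run_add, h.1, h'.1], fun r hr => ?_⟩
  rcases le_or_gt r s with hrs | hrs
  · exact h.2 r hrs
  · obtain ⟨q, rfl⟩ := Nat.exists_eq_add_of_le hrs.le
    rw [run_add, h.1]
    exact h'.2 q (by omega)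

theorem Reaches.single {P : Program} {B : ℕ} {c : Config} {i : Instr} (h : c.WordsLE B)
    (hi : P[c.pc]? = some i) (h' : (i.exec c).WordsLE B) : Reaches P B c (i.exec c) 1 := by
  have h1 : run P 1 c = i.exec c := by simp [run, step, hi]
  refine ⟨h1, fun s hs => ?_⟩
  rcases Nat.le_one_iff_eq_zero_or_eq_one.1 hs with rfl | rfl
  · exact h
  · rwa [h1]

theorem Config.WordsLE.setReg {c : Config} {B : ℕ} (h : c.WordsLE B) (r : ℕ) {v : ℕ}
    (hv : v ≤ B) : (c.setReg r v).WordsLE B := by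
  refine fun k => ⟨?_, (h k).2⟩
  simp only [Config.setReg, Function.update_apply]
  split_ifs
  · exact hv
  · exact (h k).1

variable {V : Type}

/-- The configuration `c` at line `k` represents the variables `f` and the memory `m`. -/
structure Sim (ρ : V → ℕ) (B : ℕ) (k : ℕ) (f : V → ℕ) (m : ℕ → ℕ) (c : Config) : Prop where
  pc : c.pc = k
  var : ∀ x, c.reg (2 * ρ x) = f x
  mem : c.mem = m
  words : c.WordsLE B

theorem Sim.setTemp {ρ : V → ℕ} {B k : ℕ} {f : V → ℕ} {m : ℕ → ℕ} {c : Config}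
    (h : Sim ρ B k f m c) (j v : ℕ) (hv : v ≤ B) :
    Sim ρ B (k + 1) f m (c.setReg (2 * j + 1) v) := by
  refine ⟨by simp [Config.setReg, h.pc], fun x => ?_, h.mem, h.words.setReg _ hv⟩
  rw [← h.var x]
  exact Function.update_of_ne (by omega) _ _

theorem Sim.val_le {ρ : V → ℕ} {B k : ℕ} {f : V → ℕ} {m : ℕ → ℕ} {c : Config}
    (h : Sim ρ B k f m c) (e : Arith V) (he : e.ok B f m) : e.val f m ≤ B :=
  e.val_le (fun x => h.var x ▸ (h.words _).1) (fun i => h.mem ▸ (h.words i).2) he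

/-- Temporaries are used like a stack: code for level j never writes the odd registers below level
j. This is why the left operand survives the evaluation of the right one at level j + 1, and it is
the last clause of the induction hypothesis. -/
theorem Arith.reaches {P : Program} {ρ : V → ℕ} {B : ℕ} {f : V → ℕ} {m : ℕ → ℕ} (e : Arith V) :
    ∀ {k j : ℕ} {c : Config}, CodeAt P k (e.code ρ j) → Sim ρ B k f m c → e.ok B f m →
      ∃ c', Reaches P B c c' e.cost ∧ Sim ρ B (k + e.cost) f m c' ∧
        c'.reg (2 * j + 1) = e.val f m ∧ ∀ i < j, c'.reg (2 * i + 1) = c.reg (2 * i + 1) := by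
  -- The three binary operations differ only in the final instruction, abstracted as `o` with effect
  -- `g`.
  have binary : ∀ (a b : Arith V) (o : ℕ → ℕ → ℕ → Instr) (g : ℕ → ℕ → ℕ),
      (∀ r x y c, (o r x y).exec c = c.setReg r (g (c.reg x) (c.reg y))) →
      (∀ {k j : ℕ} {c : Config}, CodeAt P k (a.code ρ j) → Sim ρ B k f m c → a.ok B f m →
        ∃ c', Reaches P B c c' a.cost ∧ Sim ρ B (k + a.cost) f m c' ∧
        c'.reg (2 * j + 1) = a.val f m ∧ ∀ i < j, c'.reg (2 * i + 1) = c.reg (2 * i + 1)) →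
      (∀ {k j : ℕ} {c : Config}, CodeAt P k (b.code ρ j) → Sim ρ B k f m c → b.ok B f m →
        ∃ c', Reaches P B c c' b.cost ∧ Sim ρ B (k + b.cost) f m c' ∧
        c'.reg (2 * j + 1) = b.val f m ∧ ∀ i < j, c'.reg (2 * i + 1) = c.reg (2 * i + 1)) →
      ∀ {k j : ℕ} {c : Config}, CodeAt P k (a.code ρ j ++ (b.code ρ (j + 1) ++
        [o (2 * j + 1) (2 * j + 1) (2 * (j + 1) + 1)])) → Sim ρ B k f m c → a.ok B f m →
      b.ok B f m → g (a.val f m) (b.val f m) ≤ B →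
      ∃ c', Reaches P B c c' (a.cost + b.cost + 1) ∧ Sim ρ B (k + (a.cost + b.cost + 1)) f m c' ∧
        c'.reg (2 * j + 1) = g (a.val f m) (b.val f m) ∧
        ∀ i < j, c'.reg (2 * i + 1) = c.reg (2 * i + 1) := by
    intro a b o g ho iha ihb k j c hc hs oka okb hg
    simp only [codeAt_append, codeAt_cons, Arith.length_code] at hc
    obtain ⟨c₁, r₁, s₁, v₁, f₁⟩ := iha hc.1 hs oka
    obtain ⟨c₂, r₂, s₂, v₂, f₂⟩ := ihb hc.2.1 s₁ okb
    have hex := ho (2 * j + 1) (2 * j + 1) (2 * (j + 1) + 1) c₂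
    rw [v₂, f₂ j (by omega), v₁] at hex
    have hs₃ := s₂.setTemp j (g (a.val f m) (b.val f m)) hg
    have r₃ := Reaches.single s₂.words (by rw [s₂.pc]; exact hc.2.2.1) (by rw [hex]; exact hs₃.words)
    rw [hex] at r₃
    refine ⟨_, (r₁.trans r₂).trans r₃, by simpa only [add_assoc] using hs₃,
      Function.update_self .., fun i hi => ?_⟩
    rw [← f₁ i hi, ← f₂ i (by omega)]
    exact Function.update_of_ne (by omega) _ _
  induction e with
  | lit v =>
    intro k j c hc hs ok
    simp only [code, codeAt_cons] at hc
    have hs' := hs.setTemp j v ok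
    exact ⟨_, Reaches.single hs.words (i := .const (2 * j + 1) v) (by rw [hs.pc]; exact hc.1)
      hs'.words, hs', Function.update_self .., fun i hi => Function.update_of_ne (by omega) _ _⟩
  | var x =>
    intro k j c hc hs ok
    simp only [code, codeAt_cons] at hc
    have hs' := hs.setTemp j (c.reg (2 * ρ x)) (hs.words _).1
    exact ⟨_, Reaches.single hs.words (i := .copy (2 * j + 1) (2 * ρ x))
      (by rw [hs.pc]; exact hc.1) hs'.words, hs', (Function.update_self ..).trans (hs.var x),
      fun i hi => Function.update_of_ne (by omega) _ _⟩
  | add a b iha ihb =>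
    intro k j c hc hs ok
    exact binary a b .add (· + ·) (fun _ _ _ _ => rfl) iha ihb hc hs ok.1 ok.2.1 ok.2.2
  | sub a b iha ihb =>
    intro k j c hc hs ok
    exact binary a b .sub (· - ·) (fun _ _ _ _ => rfl) iha ihb hc hs ok.1 ok.2
      ((Nat.sub_le _ _).trans (hs.val_le a ok.1))
  | mul a b iha ihb =>
    intro k j c hc hs ok
    exact binary a b .mul (· * ·) (fun _ _ _ _ => rfl) iha ihb hc hs ok.1 ok.2.1 ok.2.2
  | load a iha =>
    intro k j c hc hs ok
    simp only [code, codeAt_append, codeAt_cons, Arith.length_code] at hc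
    obtain ⟨c₁, r₁, s₁, v₁, f₁⟩ := iha hc.1 hs ok
    have hs' := s₁.setTemp j (c₁.mem (c₁.reg (2 * j + 1))) (s₁.words _).2
    refine ⟨_, r₁.trans (Reaches.single s₁.words (i := .load (2 * j + 1) (2 * j + 1))
      (by rw [s₁.pc]; exact hc.2.1) hs'.words), hs',
      (Function.update_self ..).trans (by rw [v₁, s₁.mem]; rfl), fun i hi => ?_⟩
    rw [← f₁ i hi]
    exact Function.update_of_ne (by omega) _ _

/-! ### Compilation and timed semantics of commands -/

namespace Cmd

/-- The number of instructions of the compiled command. -/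
def size : Cmd V → ℕ
  | skip => 0
  | assign _ e => e.cost + 1
  | store a e => a.cost + e.cost + 1
  | seq c₁ c₂ => c₁.size + c₂.size
  | ite a b c₁ c₂ => a.cost + b.cost + c₁.size + c₂.size + 4
  | loop a b c => a.cost + b.cost + c.size + 7

/-- An unconditional jump to line `p`. -/
def goto (p : ℕ) : Program := [.const 1 0, .const 3 1, .jumpLT 1 3 p]

/-- The code of a command, to be placed at line `k`. -/
def code (ρ : V → ℕ) : Cmd V → ℕ → Program
  | skip, _ => []
  | assign x e, _ => e.code ρ 0 ++ [.copy (2 * ρ x) 1]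
  | store a e, _ => a.code ρ 0 ++ (e.code ρ 1 ++ [.store 1 3])
  | seq c₁ c₂, k => c₁.code ρ k ++ c₂.code ρ (k + c₁.size)
  | ite a b c₁ c₂, k =>
      a.code ρ 0 ++ (b.code ρ 1 ++ ([.jumpLT 1 3 (k + a.cost + b.cost + c₂.size + 4)] ++
        (c₂.code ρ (k + a.cost + b.cost + 1) ++
          (goto (k + a.cost + b.cost + c₂.size + 4 + c₁.size) ++
            c₁.code ρ (k + a.cost + b.cost + c₂.size + 4)))))
  | loop a b c, k =>
      a.code ρ 0 ++ (b.code ρ 1 ++ ([.jumpLT 1 3 (k + a.cost + b.cost + 4)] ++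
        (goto (k + a.cost + b.cost + c.size + 7) ++
          (c.code ρ (k + a.cost + b.cost + 4) ++ goto k))))

@[simp] theorem length_goto (p : ℕ) : (goto p).length = 3 := rfl

@[simp] theorem length_code (ρ : V → ℕ) (c : Cmd V) (k : ℕ) : (c.code ρ k).length = c.size := by
  induction c generalizing k <;> simp_all [code, size] <;> omega

variable [DecidableEq V]

/-- Big-step semantics; every expression that is evaluated respects the word bound `B`. -/
inductive Exec (B : ℕ) : Cmd V → St V → St V → Prop
  | skip (s) : Exec B skip s s
  | assign (x e) (s : St V) : e.ok B s.var s.mem →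
      Exec B (assign x e) s
        ⟨Function.update s.var x (e.val s.var s.mem), s.mem, s.time + (e.cost + 1)⟩
  | store (a e) (s : St V) : a.ok B s.var s.mem → e.ok B s.var s.mem →
      Exec B (store a e) s
        ⟨s.var, Function.update s.mem (a.val s.var s.mem) (e.val s.var s.mem),
          s.time + (a.cost + e.cost + 1)⟩
  | seq {c₁ c₂ s s' s''} : Exec B c₁ s s' → Exec B c₂ s' s'' → Exec B (seq c₁ c₂) s s''
  | ite_true {a b c₁ c₂} {s s' : St V} : a.ok B s.var s.mem → b.ok B s.var s.mem →
      a.val s.var s.mem < b.val s.var s.mem →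
      Exec B c₁ ⟨s.var, s.mem, s.time + (a.cost + b.cost + 1)⟩ s' → Exec B (ite a b c₁ c₂) s s'
  -- The code of the else branch comes first and ends with a three-instruction jump over the then
  -- branch; hence 4 here against 1 in the true case.
  | ite_false {a b c₁ c₂} {s s' : St V} : a.ok B s.var s.mem → b.ok B s.var s.mem →
      ¬ a.val s.var s.mem < b.val s.var s.mem →
      Exec B c₂ ⟨s.var, s.mem, s.time + (a.cost + b.cost + 4)⟩ s' → Exec B (ite a b c₁ c₂) s s'
  | loop_exit {a b c} {s : St V} : a.ok B s.var s.mem → b.ok B s.var s.mem →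
      ¬ a.val s.var s.mem < b.val s.var s.mem →
      Exec B (loop a b c) s ⟨s.var, s.mem, s.time + (a.cost + b.cost + 4)⟩
  -- The conditional jump together with the three-instruction jump back to the test accounts for the
  -- 4, charged before the body runs.
  | loop_step {a b c} {s s' s'' : St V} : a.ok B s.var s.mem → b.ok B s.var s.mem →
      a.val s.var s.mem < b.val s.var s.mem →
      Exec B c ⟨s.var, s.mem, s.time + (a.cost + b.cost + 4)⟩ s' →
      Exec B (loop a b c) s' s'' → Exec B (loop a b c) s s''

end Cmd

theorem reaches_goto {P : Program} {ρ : V → ℕ} {B k p : ℕ} {f : V → ℕ} {m : ℕ → ℕ} {c : Config}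
    (hB : 1 ≤ B) (hc : CodeAt P k (Cmd.goto p)) (hs : Sim ρ B k f m c) :
    ∃ c', Reaches P B c c' 3 ∧ Sim ρ B p f m c' := by
  simp only [Cmd.goto, codeAt_cons] at hc
  have s₁ := hs.setTemp 0 0 (Nat.zero_le _)
  have s₂ := s₁.setTemp 1 1 hB
  have r₁ := Reaches.single hs.words (i := .const 1 0) (by rw [hs.pc]; exact hc.1) s₁.words
  have r₂ := Reaches.single s₁.words (i := .const 3 1) (by rw [s₁.pc]; exact hc.2.1) s₂.words
  have r₃ := Reaches.single s₂.words (i := .jumpLT 1 3 p) (by rw [s₂.pc]; exact hc.2.2.1) s₂.words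
  refine ⟨_, (r₁.trans r₂).trans r₃, ?_, s₂.var, s₂.mem, s₂.words⟩
  simp [Instr.exec, Config.setReg]

/-- Evaluating a condition and jumping. -/
theorem reaches_jump {P : Program} {ρ : V → ℕ} {B k p : ℕ} {f : V → ℕ} {m : ℕ → ℕ} {c : Config}
    {a b : Arith V} (ha : CodeAt P k (a.code ρ 0)) (hb : CodeAt P (k + a.cost) (b.code ρ 1))
    (hj : P[k + a.cost + b.cost]? = some (.jumpLT 1 3 p)) (hs : Sim ρ B k f m c)
    (oka : a.ok B f m) (okb : b.ok B f m) :
    ∃ c', Reaches P B c c' (a.cost + b.cost + 1) ∧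
      Sim ρ B (if a.val f m < b.val f m then p else k + a.cost + b.cost + 1) f m c' := by
  obtain ⟨c₁, r₁, s₁, v₁, -⟩ := a.reaches ha hs oka
  obtain ⟨c₂, r₂, s₂, v₂, f₂⟩ := b.reaches hb s₁ okb
  have v₁' := f₂ 0 (by omega)
  rw [v₁] at v₁'
  have r₃ := Reaches.single s₂.words (i := .jumpLT 1 3 p) (by rw [s₂.pc]; exact hj) s₂.words
  refine ⟨_, (r₁.trans r₂).trans r₃, ?_, s₂.var, s₂.mem, s₂.words⟩
  simp only [Instr.exec]
  rw [show c₂.reg 1 = _ from v₁', show c₂.reg 3 = _ from v₂, s₂.pc]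

-- Simulation by induction on the big-step derivation. The time recorded by the semantics is the
-- exact number of machine steps, so bounds proved for commands hold for the machine. The assumption
-- `1 ≤ B` is needed because an unconditional jump compares the constants 0 and 1.
open Cmd in
theorem Cmd.Exec.reaches [DecidableEq V] {P : Program} {ρ : V → ℕ} (hρ : Function.Injective ρ)
    {B : ℕ} (hB : 1 ≤ B) {c : Cmd V} {s s' : St V} (h : Exec B c s s') :
    ∀ {k : ℕ} {g : Config}, CodeAt P k (c.code ρ k) → Sim ρ B k s.var s.mem g →
      ∃ g' t, s'.time = s.time + t ∧ Reaches P B g g' t ∧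
        Sim ρ B (k + c.size) s'.var s'.mem g' := by
  induction h with
  | skip s =>
    intro k g _ hs
    exact ⟨g, 0, rfl, Reaches.refl hs.words, hs⟩
  | assign x e s ok =>
    intro k g hc hs
    simp only [code, codeAt_append, codeAt_cons, Arith.length_code] at hc
    obtain ⟨c₁, r₁, s₁, v₁, -⟩ := e.reaches hc.1 hs ok
    have w : ((Instr.copy (2 * ρ x) 1).exec c₁).WordsLE B := s₁.words.setReg _ (s₁.words _).1
    refine ⟨_, _, rfl, r₁.trans (Reaches.single s₁.words (by rw [s₁.pc]; exact hc.2.1) w), ?_, ?_,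
      s₁.mem, w⟩
    · simp [Instr.exec, Config.setReg, s₁.pc, size, add_assoc]
    · intro y
      simp only [Instr.exec, Config.setReg, Function.update_apply]
      rw [show c₁.reg 1 = _ from v₁, s₁.var y]
      have : 2 * ρ y = 2 * ρ x ↔ y = x := by rw [← hρ.eq_iff (a := y)]; omega
      simp [this]
  | store a e s oka oke =>
    intro k g hc hs
    simp only [code, codeAt_append, codeAt_cons, Arith.length_code] at hc
    obtain ⟨c₁, r₁, s₁, v₁, -⟩ := a.reaches hc.1 hs oka
    obtain ⟨c₂, r₂, s₂, v₂, f₂⟩ := e.reaches hc.2.1 s₁ oke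
    have v₁' := f₂ 0 (by omega)
    rw [v₁] at v₁'
    have w : ((Instr.store 1 3).exec c₂).WordsLE B := by
      refine fun i => ⟨(s₂.words i).1, ?_⟩
      simp only [Instr.exec, Function.update_apply]
      split_ifs
      · exact (s₂.words _).1
      · exact (s₂.words _).2
    refine ⟨_, _, rfl,
      (r₁.trans r₂).trans (Reaches.single s₂.words (by rw [s₂.pc]; exact hc.2.2.1) w), ?_,
      s₂.var, ?_, w⟩
    · simp [Instr.exec, s₂.pc, size, add_assoc]
    · simp only [Instr.exec]
      rw [show c₂.reg 1 = _ from v₁', show c₂.reg 3 = _ from v₂, s₂.mem]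
  | seq _ _ ih₁ ih₂ =>
    intro k g hc hs
    simp only [code, codeAt_append, length_code] at hc
    obtain ⟨g₁, t₁, e₁, r₁, s₁⟩ := ih₁ hc.1 hs
    obtain ⟨g₂, t₂, e₂, r₂, s₂⟩ := ih₂ hc.2 s₁
    exact ⟨g₂, t₁ + t₂, by omega, r₁.trans r₂, by simpa only [size, add_assoc] using s₂⟩
  | ite_true oka okb hlt _ ih =>
    intro k g hc hs
    simp only [code, codeAt_append, codeAt_cons, length_code, length_goto, Arith.length_code,
      List.length_cons, List.length_nil, zero_add] at hc
    obtain ⟨ha, hb, ⟨hj, -⟩, -, -, hc₁⟩ := hc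
    obtain ⟨g₁, r₁, s₁⟩ := reaches_jump ha hb hj hs oka okb
    rw [if_pos hlt] at s₁
    obtain ⟨g₂, t₂, e₂, r₂, s₂⟩ := ih (by convert hc₁ using 1; omega) s₁
    refine ⟨g₂, _, ?_, r₁.trans r₂, ?_⟩
    · rw [e₂, add_assoc]
    · convert s₂ using 1
      simp only [size]; omega
  | ite_false oka okb hlt _ ih =>
    intro k g hc hs
    simp only [code, codeAt_append, codeAt_cons, length_code, length_goto, Arith.length_code,
      List.length_cons, List.length_nil, zero_add] at hc
    obtain ⟨ha, hb, ⟨hj, -⟩, hc₂, hg, -⟩ := hc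
    obtain ⟨g₁, r₁, s₁⟩ := reaches_jump ha hb hj hs oka okb
    rw [if_neg hlt] at s₁
    obtain ⟨g₂, t₂, e₂, r₂, s₂⟩ := ih (by convert hc₂ using 1) s₁
    obtain ⟨g₃, r₃, s₃⟩ := reaches_goto hB hg s₂
    refine ⟨g₃, _, ?_, (r₁.trans r₂).trans r₃, ?_⟩
    · rw [e₂]; ring
    · convert s₃ using 1
      simp only [size]; omega
  | loop_exit oka okb hlt =>
    intro k g hc hs
    simp only [code, codeAt_append, codeAt_cons, length_code, length_goto, Arith.length_code,
      List.length_cons, List.length_nil, zero_add] at hc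
    obtain ⟨ha, hb, ⟨hj, -⟩, hg, -⟩ := hc
    obtain ⟨g₁, r₁, s₁⟩ := reaches_jump ha hb hj hs oka okb
    rw [if_neg hlt] at s₁
    obtain ⟨g₃, r₃, s₃⟩ := reaches_goto hB hg s₁
    refine ⟨g₃, _, ?_, r₁.trans r₃, ?_⟩
    · rfl
    · convert s₃ using 1
      simp only [size]; omega
  | loop_step oka okb hlt _ _ ih₁ ih₂ =>
    intro k g hc hs
    have hc' := hc
    simp only [code, codeAt_append, codeAt_cons, length_code, length_goto, Arith.length_code,
      List.length_cons, List.length_nil, zero_add] at hc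
    obtain ⟨ha, hb, ⟨hj, -⟩, -, hc₁, hg⟩ := hc
    obtain ⟨g₁, r₁, s₁⟩ := reaches_jump ha hb hj hs oka okb
    rw [if_pos hlt] at s₁
    obtain ⟨g₂, t₂, e₂, r₂, s₂⟩ := ih₁ (by convert hc₁ using 1) s₁
    obtain ⟨g₃, r₃, s₃⟩ := reaches_goto hB (by convert hg using 1) s₂
    obtain ⟨g₄, t₄, e₄, r₄, s₄⟩ := ih₂ hc' s₃
    refine ⟨g₄, _, ?_, ((r₁.trans r₂).trans r₃).trans r₄, s₄⟩
    rw [e₄, e₂]; ring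

/-! ### Total correctness rules with time bounds -/

namespace Cmd

variable [DecidableEq V]

theorem Exec.time_le {B : ℕ} {c : Cmd V} {s s' : St V} (h : Exec B c s s') : s.time ≤ s'.time := by
  induction h <;> first | omega | (simp only at *; omega)

/-- The command `c` terminates from `s` within the word bound `B`, in a state satisfying `Q`. -/
def wp (B : ℕ) (c : Cmd V) (Q : St V → Prop) (s : St V) : Prop := ∃ s', Exec B c s s' ∧ Q s'

theorem wp.mono {B : ℕ} {c : Cmd V} {Q Q' : St V → Prop} {s : St V} (h : wp B c Q s)
    (hQ : ∀ s', s.time ≤ s'.time → Q s' → Q' s') : wp B c Q' s := by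
  obtain ⟨s', h, hq⟩ := h
  exact ⟨s', h, hQ s' h.time_le hq⟩

theorem wp_skip {B : ℕ} {Q : St V → Prop} {s : St V} (h : Q s) : wp B skip Q s := ⟨s, .skip s, h⟩

theorem wp_assign {B : ℕ} {x : V} {e : Arith V} {Q : St V → Prop} {s : St V}
    (ok : e.ok B s.var s.mem)
    (h : Q ⟨Function.update s.var x (e.val s.var s.mem), s.mem, s.time + (e.cost + 1)⟩) :
    wp B (assign x e) Q s := ⟨_, .assign x e s ok, h⟩

theorem wp_store {B : ℕ} {a e : Arith V} {Q : St V → Prop} {s : St V} (oka : a.ok B s.var s.mem)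
    (oke : e.ok B s.var s.mem)
    (h : Q ⟨s.var, Function.update s.mem (a.val s.var s.mem) (e.val s.var s.mem),
          s.time + (a.cost + e.cost + 1)⟩) :
    wp B (store a e) Q s := ⟨_, .store a e s oka oke, h⟩

theorem wp_seq {B : ℕ} {c₁ c₂ : Cmd V} {Q : St V → Prop} {s : St V}
    (h : wp B c₁ (wp B c₂ Q) s) : wp B (seq c₁ c₂) Q s := by
  obtain ⟨s', h₁, s'', h₂, hq⟩ := h
  exact ⟨s'', h₁.seq h₂, hq⟩

theorem wp_ite {B : ℕ} {a b : Arith V} {c₁ c₂ : Cmd V} {Q : St V → Prop} {s : St V}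
    (oka : a.ok B s.var s.mem) (okb : b.ok B s.var s.mem)
    (h₁ : a.val s.var s.mem < b.val s.var s.mem →
      wp B c₁ Q ⟨s.var, s.mem, s.time + (a.cost + b.cost + 1)⟩)
    (h₂ : b.val s.var s.mem ≤ a.val s.var s.mem →
      wp B c₂ Q ⟨s.var, s.mem, s.time + (a.cost + b.cost + 4)⟩) :
    wp B (ite a b c₁ c₂) Q s := by
  by_cases h : a.val s.var s.mem < b.val s.var s.mem
  · obtain ⟨s', h', hq⟩ := h₁ h
    exact ⟨s', .ite_true oka okb h h', hq⟩
  · obtain ⟨s', h', hq⟩ := h₂ (not_lt.1 h)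
    exact ⟨s', .ite_false oka okb h h', hq⟩

/-- A loop terminates if an invariant bounds the time; each iteration takes time. -/
theorem wp_loop {B : ℕ} {a b : Arith V} {c : Cmd V} (T : ℕ) (I : St V → Prop)
    (hT : ∀ s, I s → s.time ≤ T)
    (ok : ∀ s, I s → a.ok B s.var s.mem ∧ b.ok B s.var s.mem)
    (body : ∀ s, I s → a.val s.var s.mem < b.val s.var s.mem →
      wp B c I ⟨s.var, s.mem, s.time + (a.cost + b.cost + 4)⟩) {s : St V} (hs : I s) :
    wp B (loop a b c) (fun s' => ∃ s₀, I s₀ ∧ b.val s₀.var s₀.mem ≤ a.val s₀.var s₀.mem ∧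
      s' = ⟨s₀.var, s₀.mem, s₀.time + (a.cost + b.cost + 4)⟩) s := by
  obtain ⟨k, hk⟩ : ∃ k, k = T - s.time := ⟨_, rfl⟩
  induction k using Nat.strong_induction_on generalizing s with
  | _ k ih =>
    by_cases h : a.val s.var s.mem < b.val s.var s.mem
    · obtain ⟨s₁, e₁, h₁⟩ := body s hs h
      have t₁ := e₁.time_le
      have := hT s₁ h₁
      simp only at t₁
      obtain ⟨s₂, e₂, h₂⟩ := ih (T - s₁.time) (by omega) h₁ rfl
      exact ⟨s₂, .loop_step (ok s hs).1 (ok s hs).2 h e₁ e₂, h₂⟩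
    · exact ⟨_, .loop_exit (ok s hs).1 (ok s hs).2 h, s, hs, not_lt.1 h, rfl⟩

/-- `for x = 0, …, e - 1 do c`. -/
def forRange (x : V) (e : Arith V) (c : Cmd V) : Cmd V :=
  seq (assign x (.lit 0)) (loop (.var x) e (seq c (assign x (.add (.var x) (.lit 1)))))

/-- The limit `e` is evaluated again before every iteration, so the invariant has to guarantee its
value `m` throughout. `K` bounds one run of the body, which must leave the counter as it found it.
-/
theorem wp_forRange {B : ℕ} {x : V} {e : Arith V} {c : Cmd V} {m K : ℕ} (hm : m ≤ B) (hB : 1 ≤ B)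
    (I : ℕ → (V → ℕ) → (ℕ → ℕ) → Prop)
    (hI : ∀ k f M, I k f M → f x = k ∧ e.val f M = m ∧ e.ok B f M)
    (body : ∀ k < m, ∀ s : St V, I k s.var s.mem →
      wp B c (fun s' => s'.time ≤ s.time + K ∧ s'.var x = k ∧
        I (k + 1) (Function.update s'.var x (k + 1)) s'.mem) s)
    {s : St V} (h₀ : I 0 (Function.update s.var x 0) s.mem) :
    wp B (forRange x e c) (fun s' => I m s'.var s'.mem ∧
      s'.time ≤ s.time + m * (K + e.cost + 10) + e.cost + 10) s := by
  refine wp_seq (wp_assign (Nat.zero_le _) ?_)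
  refine wp.mono (wp_loop (s.time + 10 + m * (K + e.cost + 10))
    (fun s' => ∃ k ≤ m, I k s'.var s'.mem ∧ s'.time ≤ s.time + 2 + k * (K + e.cost + 10))
    ?_ ?_ ?_ ⟨0, Nat.zero_le _, h₀, ?_⟩) ?_
  · rintro s' ⟨k, hk, -, ht⟩
    have := Nat.mul_le_mul_right (K + e.cost + 10) hk
    omega
  · rintro s' ⟨k, hk, h, ht⟩
    exact ⟨trivial, (hI _ _ _ h).2.2⟩
  · rintro s' ⟨k, hk, h, ht⟩ hlt
    simp only [Arith.val, (hI _ _ _ h).1, (hI _ _ _ h).2.1] at hlt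
    refine wp_seq (wp.mono (body k hlt _ h) ?_)
    rintro s₁ - ⟨h₁, h₂, h₃⟩
    refine wp_assign ?_ ⟨k + 1, hlt, ?_, ?_⟩
    · simp only [Arith.ok, Arith.val, h₂]; exact ⟨trivial, hB, by omega⟩
    · simpa only [Arith.val, h₂] using h₃
    · simp only [Arith.cost] at h₁ ⊢
      rw [add_mul]
      omega
  · simp
  · rintro s' - ⟨s₀, ⟨k, hk, h, ht⟩, hle, rfl⟩
    simp only [Arith.val, (hI _ _ _ h).1, (hI _ _ _ h).2.1] at hle
    obtain rfl : k = m := by omega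
    refine ⟨h, ?_⟩
    simp only [Arith.cost]
    omega

end Cmd

end WordRAM

/-! ### Hall's theorem for interval domains -/

section

open Finset

/-- Hall's condition for intervals implies Hall's condition. -/
theorem card_le_card_biUnion_of_intervals {J Z : Finset ℕ} {l u : ℕ → ℕ}
    (hl : ∀ j ∈ J, 1 ≤ l j)
    (h : ∀ p q, #{j ∈ J | p < l j ∧ u j ≤ q} ≤ #{t ∈ Z | p < t ∧ t ≤ q}) (s : Finset ℕ)
    (hs : s ⊆ J) : #s ≤ #(s.biUnion fun j => {t ∈ Z | l j ≤ t ∧ t ≤ u j}) := by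
  induction s using Finset.strongInduction with
  | H s ih =>
    rcases s.eq_empty_or_nonempty with rfl | hne
    · simp
    obtain ⟨i, hi, hmin⟩ := s.exists_min_image l hne
    obtain ⟨k, hk, hmax⟩ := s.exists_max_image u hne
    -- Either the neighbourhood of `s` contains all available values in the hull of its intervals,
    -- and the hypothesis for this hull applies, or some available value `z` in the hull is missed.
    -- Then every interval lies strictly to one side of `z`, and `s` splits into two smaller sets
    -- with disjoint neighbourhoods.
    by_cases hU : {t ∈ Z | l i - 1 < t ∧ t ≤ u k} ⊆
        s.biUnion fun j => {t ∈ Z | l j ≤ t ∧ t ≤ u j}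
    · refine (card_le_card fun j hj => ?_).trans ((h (l i - 1) (u k)).trans (card_le_card hU))
      have := hmin j hj
      have := hl i (hs hi)
      exact mem_filter.2 ⟨hs hj, by omega, hmax j hj⟩
    · obtain ⟨z, hz, hzU⟩ := not_subset.1 hU
      simp only [mem_filter, mem_biUnion, not_exists, not_and] at hz hzU
      have hsplit : ∀ j ∈ s, ¬ z < l j → u j < z := fun j hj hlt => by
        have := hzU j hj hz.1 (by omega)
        omega
      have hlt₁ : {j ∈ s | z < l j} ⊂ s :=
        ⟨filter_subset _ _, fun hsub => by have := (mem_filter.1 (hsub hi)).2; omega⟩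
      have hlt₂ : {j ∈ s | ¬ z < l j} ⊂ s :=
        ⟨filter_subset _ _, fun hsub => by
          have := hsplit k hk (mem_filter.1 (hsub hk)).2; omega⟩
      rw [← card_filter_add_card_filter_not (fun j => z < l j)]
      refine (add_le_add (ih _ hlt₁ (hlt₁.1.trans hs)) (ih _ hlt₂ (hlt₂.1.trans hs))).trans ?_
      rw [← card_union_of_disjoint]
      · exact card_le_card (union_subset (biUnion_subset_biUnion_of_subset_left _ hlt₁.1)
          (biUnion_subset_biUnion_of_subset_left _ hlt₂.1))
      · rw [disjoint_left]
        intro t ht₁ ht₂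
        simp only [mem_biUnion, mem_filter] at ht₁ ht₂
        obtain ⟨j, hj, -, hj', -⟩ := ht₁
        obtain ⟨j', hj₂, -, -, hj₂'⟩ := ht₂
        have := hsplit j' hj₂.1 hj₂.2
        omega

/-- Hall's theorem for intervals. -/
theorem exists_injOn_of_intervals {J Z : Finset ℕ} {l u : ℕ → ℕ} (hl : ∀ j ∈ J, 1 ≤ l j)
    (h : ∀ p q, #{j ∈ J | p < l j ∧ u j ≤ q} ≤ #{t ∈ Z | p < t ∧ t ≤ q}) :
    ∃ f : ℕ → ℕ, Set.InjOn f J ∧ ∀ j ∈ J, f j ∈ Z ∧ l j ≤ f j ∧ f j ≤ u j := by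
  obtain ⟨f, hf, hft⟩ := (all_card_le_biUnion_card_iff_exists_injective
    (fun j : J => {t ∈ Z | l j ≤ t ∧ t ≤ u j})).1 fun s => by
      have := card_le_card_biUnion_of_intervals hl h (s.map (Function.Embedding.subtype _))
        (fun j hj => by
          obtain ⟨⟨j', hj'⟩, -, rfl⟩ := mem_map.1 hj
          exact hj')
      rw [card_map, map_eq_image, image_biUnion] at this
      exact this
  refine ⟨fun j => if hj : j ∈ J then f ⟨j, hj⟩ else 0, fun i hi j hj hij => ?_, fun j hj => ?_⟩
  · simp only [Finset.mem_coe] at hi hj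
    simp only [dif_pos hi, dif_pos hj] at hij
    simpa using hf hij
  · simpa [hj] using hft ⟨j, hj⟩

/-- The number of `j < n` with `e j = 0` whose interval `[l j, u j]` is contained in `(p, q]`. -/
def intervalCount (e l u : ℕ → ℕ) (n p q : ℕ) : ℕ :=
  ∑ j ∈ range n, (1 - (e j + (p + 1 - l j) + (u j - q)))

/-- A summand is 1 exactly when all three truncated quantities vanish. The sum has this form because
the machine can evaluate it with truncated subtraction, without branching. -/
theorem intervalCount_eq_card (e l u : ℕ → ℕ) (n p q : ℕ) :
    intervalCount e l u n p q = #{j ∈ range n | e j = 0 ∧ p < l j ∧ u j ≤ q} := by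
  rw [intervalCount, card_filter]
  refine sum_congr rfl fun j _ => ?_
  split_ifs <;> omega

theorem intervalCount_le (e l u : ℕ → ℕ) (n p q : ℕ) : intervalCount e l u n p q ≤ n := by
  rw [intervalCount_eq_card]
  simpa using card_filter_le (range n) fun j => e j = 0 ∧ p < l j ∧ u j ≤ q

theorem intervalCount_eq_zero {e l u : ℕ → ℕ} {n p q : ℕ} (h : ∀ j < n, l j ≤ u j) (hpq : q ≤ p) :
    intervalCount e l u n p q = 0 := by
  rw [intervalCount]
  refine sum_eq_zero fun j hj => ?_
  have := h j (mem_range.1 hj)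
  omega

/-! ### Equivalence with a system of difference constraints -/

/-- Interval domains and membership bits `σ`, `τ` of two sets that cover all variables. -/
structure OadInstance (n d : ℕ) (l u σ τ : ℕ → ℕ) : Prop where
  one_le : ∀ j < n, 1 ≤ l j
  le : ∀ j < n, l j ≤ u j
  le_d : ∀ j < n, u j ≤ d
  left_le : ∀ j < n, σ j ≤ 1
  right_le : ∀ j < n, τ j ≤ 1
  cover : ∀ j < n, 1 ≤ σ j + τ j

/-- The assignment `a` is a solution. -/
def OadSolution (n : ℕ) (l u σ τ a : ℕ → ℕ) : Prop :=
  (∀ j < n, l j ≤ a j ∧ a j ≤ u j) ∧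
    ∀ j < n, ∀ k < n, j ≠ k → a j = a k → ¬ (σ j = 1 ∧ σ k = 1) ∧ ¬ (τ j = 1 ∧ τ k = 1)

/-- The weights of the difference constraints. -/
def oadWeight (n : ℕ) (l u σ τ : ℕ → ℕ) (p q : ℕ) : ℕ :=
  max (intervalCount (fun j => 1 - σ j + (1 - τ j)) l u n p q)
    (max (intervalCount τ l u n q p) (intervalCount σ l u n q p))

/-- The system of difference constraints with weights `w`. -/
def DiffSystem (d : ℕ) (w : ℕ → ℕ → ℕ) (z : ℕ → ℕ) : Prop :=
  ∀ p ≤ d, ∀ q ≤ d, z p + w p q ≤ z q + (p - q)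

theorem oadWeight_le (n : ℕ) (l u σ τ : ℕ → ℕ) (p q : ℕ) : oadWeight n l u σ τ p q ≤ n := by
  simp [oadWeight, intervalCount_le]

theorem oadWeight_self {n : ℕ} {l u σ τ : ℕ → ℕ} (h : ∀ j < n, l j ≤ u j) (p : ℕ) :
    oadWeight n l u σ τ p p = 0 := by
  simp [oadWeight, intervalCount_eq_zero h le_rfl]

section

variable {n d : ℕ} {l u σ τ : ℕ → ℕ}

theorem OadInstance.swap (h : OadInstance n d l u σ τ) : OadInstance n d l u τ σ :=
  ⟨h.one_le, h.le, h.le_d, h.right_le, h.left_le, fun j hj => by have := h.cover j hj; omega⟩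

theorem OadSolution.swap {a : ℕ → ℕ} (h : OadSolution n l u σ τ a) : OadSolution n l u τ σ a :=
  ⟨h.1, fun j hj k hk hjk he => (h.2 j hj k hk hjk he).symm⟩

/-- Pigeonhole on the values in (q, p]: the variables of S ∩ T taking a value there and the
variables of S \ T confined there all belong to S, hence take different values. The statement for T
follows by `swap`. -/
theorem OadSolution.count_le {a : ℕ → ℕ} (ha : OadSolution n l u σ τ a)
    (h : OadInstance n d l u σ τ) {p q : ℕ} (hqp : q ≤ p) :
    #{j ∈ range n | (1 - σ j + (1 - τ j) = 0) ∧ a j ≤ p} + intervalCount τ l u n q p ≤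
      #{j ∈ range n | (1 - σ j + (1 - τ j) = 0) ∧ a j ≤ q} + (p - q) := by
  set E := {j ∈ range n | (1 - σ j + (1 - τ j) = 0) ∧ a j ≤ p}
  set F := {j ∈ range n | (1 - σ j + (1 - τ j) = 0) ∧ a j ≤ q}
  set G := {j ∈ range n | τ j = 0 ∧ q < l j ∧ u j ≤ p}
  have hFE : F ⊆ E := fun j hj => by
    simp only [F, E, mem_filter] at hj ⊢
    exact ⟨hj.1, hj.2.1, hj.2.2.trans hqp⟩
  have hdisj : Disjoint (E \ F) G := disjoint_left.2 fun j hj hj' => by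
    simp only [F, E, G, mem_sdiff, mem_filter] at hj hj'
    omega
  have hinj : #((E \ F) ∪ G) ≤ #(Ioc q p) := by
    refine card_le_card_of_injOn a (fun j hj => ?_) fun j hj k hk hjk => ?_
    · simp only [F, E, G, coe_union, Set.mem_union, mem_coe, mem_sdiff, mem_filter, mem_range]
        at hj
      have : j < n := by omega
      have := ha.1 j this
      simp only [coe_Ioc, Set.mem_Ioc]
      omega
    · simp only [F, E, G, coe_union, Set.mem_union, mem_coe, mem_sdiff, mem_filter, mem_range]
        at hj hk
      by_contra hne
      have hjn : j < n := by omega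
      have hkn : k < n := by omega
      have := (ha.2 j hjn k hkn hne hjk).1
      have := h.left_le j hjn
      have := h.left_le k hkn
      have := h.cover j hjn
      have := h.cover k hkn
      omega
  rw [card_union_of_disjoint hdisj, card_sdiff_of_subset hFE, Nat.card_Ioc] at hinj
  have := card_le_card hFE
  rw [show intervalCount τ l u n q p = #G from intervalCount_eq_card ..]
  omega

/-- A solution gives a solution of the difference constraints. -/
theorem OadSolution.exists_diffSystem {a : ℕ → ℕ} (ha : OadSolution n l u σ τ a)
    (h : OadInstance n d l u σ τ) :
    ∃ z, DiffSystem d (oadWeight n l u σ τ) z ∧ z 0 = 0 := by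
  refine ⟨fun t => #{j ∈ range n | (1 - σ j + (1 - τ j) = 0) ∧ a j ≤ t}, fun p _ q _ => ?_, ?_⟩
  · simp only
    -- For q ≤ p the S ∩ T component of the weight vanishes, and for p < q the other two do. So one
    -- weight, with the truncated term p - q, encodes both kinds of inequality.
    rcases le_or_gt q p with hqp | hpq
    · have h₁ := ha.count_le h hqp
      have h₂ := ha.swap.count_le h.swap hqp
      have h₃ := intervalCount_eq_zero (e := fun j => 1 - σ j + (1 - τ j)) h.le hqp
      simp only [add_comm (1 - τ _)] at h₂
      simp only [oadWeight]
      omega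
    · have h₁ := intervalCount_eq_zero (e := τ) h.le hpq.le
      have h₂ := intervalCount_eq_zero (e := σ) h.le hpq.le
      rw [oadWeight, h₁, h₂, max_self, max_eq_left (Nat.zero_le _), intervalCount_eq_card,
        ← card_union_of_disjoint]
      · refine (card_le_card fun j hj => ?_).trans (Nat.le_add_right _ _)
        simp only [mem_union, mem_filter, mem_range] at hj ⊢
        have : j < n := by omega
        have := ha.1 j this
        omega
      · refine disjoint_left.2 fun j hj hj' => ?_
        simp only [mem_filter, mem_range] at hj hj'
        have := ha.1 j hj.1
        omega
  · simp only [card_eq_zero, filter_eq_empty_iff, mem_range]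
    intro j hj
    have := ha.1 j hj
    have := h.one_le j hj
    omega

theorem card_increments {z : ℕ → ℕ} {p q : ℕ} (hpq : p ≤ q)
    (hz : ∀ t, p < t → t ≤ q → z (t - 1) ≤ z t ∧ z t ≤ z (t - 1) + 1) :
    z q = z p + #{t ∈ Ioc p q | z (t - 1) < z t} := by
  induction q, hpq using Nat.le_induction with
  | base => simp
  | succ q hpq ih =>
    have h := hz (q + 1) (by omega) le_rfl
    have ih := ih fun t ht ht' => hz t ht (by omega)
    rw [← insert_Ioc_right_eq_Ioc_add_one hpq, filter_insert]
    simp only [add_tsub_cancel_right] at h ⊢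
    split_ifs with hlt
    · rw [card_insert_of_notMem (by simp)]
      omega
    · omega

/-- A solution of the difference constraints gives a solution. -/
theorem DiffSystem.exists_solution {z : ℕ → ℕ} (hz : DiffSystem d (oadWeight n l u σ τ) z)
    (h : OadInstance n d l u σ τ) : ∃ a, OadSolution n l u σ τ a := by
  -- Adjacent nodes give the two bounds: from t - 1 to t the truncated right-hand term is 0, from t
  -- to t - 1 it is 1, and weights are nonnegative.
  have hstep : ∀ t, 0 < t → t ≤ d → z (t - 1) ≤ z t ∧ z t ≤ z (t - 1) + 1 := fun t h0 ht => by
    have h₁ := hz (t - 1) (by omega) t ht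
    have h₂ := hz t ht (t - 1) (by omega)
    omega
  -- Hall's theorem for one of the three classes, selected by `e j = 0`, with the set `Z` of values
  -- reserved for it.
  have key : ∀ (e : ℕ → ℕ) (Z : Finset ℕ), (∀ p q, p ≤ q → q ≤ d →
      intervalCount e l u n p q ≤ #{t ∈ Z | p < t ∧ t ≤ q}) →
      ∃ f : ℕ → ℕ, (∀ j < n, e j = 0 → ∀ k < n, e k = 0 → f j = f k → j = k) ∧
        ∀ j < n, e j = 0 → f j ∈ Z ∧ l j ≤ f j ∧ f j ≤ u j := by
    intro e Z hZ
    obtain ⟨f, hf, hft⟩ := exists_injOn_of_intervals (J := {j ∈ range n | e j = 0}) (Z := Z)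
      (l := l) (u := u) (fun j hj => h.one_le j (by simp at hj; exact hj.1)) (fun p q => by
        rw [filter_filter]
        -- The constraints concern nodes up to d only. As all intervals end by d, the right end may
        -- be cut off at d; if p lies beyond it, no interval fits.
        rcases le_or_gt p (min q d) with hp | hp
        · have h₁ := hZ p (min q d) hp (min_le_right _ _)
          rw [intervalCount_eq_card] at h₁
          refine (card_le_card fun j hj => ?_).trans (h₁.trans (card_le_card fun t ht => ?_))
          · simp only [mem_filter, mem_range] at hj ⊢
            have := h.le_d j hj.1
            omega
          · simp only [mem_filter] at ht ⊢
            exact ⟨ht.1, by omega⟩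
        · rw [filter_eq_empty_iff.2, card_empty]
          · exact Nat.zero_le _
          · intro j hj
            have := h.le j (mem_range.1 hj)
            have := h.le_d j (mem_range.1 hj)
            omega)
    refine ⟨f, fun j hj hej k hk hek hjk => hf ?_ ?_ hjk, fun j hj hej => hft j ?_⟩ <;>
    simp [*]
  have hcard : ∀ p q, p ≤ q → q ≤ d → z q = z p + #{t ∈ Ioc p q | z (t - 1) < z t} :=
    fun p q hpq hq => card_increments hpq fun t ht ht' => hstep t (by omega) (by omega)
  obtain ⟨f, hf, hft⟩ := key (fun j => 1 - σ j + (1 - τ j)) {t ∈ Ioc 0 d | z (t - 1) < z t}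
    fun p q hpq hq => by
      have h₁ := hcard p q hpq hq
      have h₂ := hz p (by omega) q hq
      simp only [oadWeight] at h₂
      have : #{t ∈ Ioc p q | z (t - 1) < z t} ≤
          #{t ∈ {t ∈ Ioc 0 d | z (t - 1) < z t} | p < t ∧ t ≤ q} := card_le_card fun t ht => by
        simp only [mem_filter, mem_Ioc] at ht ⊢
        omega
      omega
  -- In (p, q] the constraint from q back to p limits the number of jumps to q - p minus the count,
  -- so at least as many non-jumps remain.
  have hcompl : ∀ (e : ℕ → ℕ), (∀ p q, intervalCount e l u n q p ≤ oadWeight n l u σ τ p q) →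
      ∀ p q, p ≤ q → q ≤ d → intervalCount e l u n p q ≤
        #{t ∈ {t ∈ Ioc 0 d | ¬ z (t - 1) < z t} | p < t ∧ t ≤ q} := by
    intro e he p q hpq hq
    have h₁ := hcard p q hpq hq
    have h₂ := hz q hq p (by omega)
    have h₃ := he q p
    have h₄ := card_filter_add_card_filter_not (s := Ioc p q) (fun t => z (t - 1) < z t)
    rw [Nat.card_Ioc] at h₄
    have : #{t ∈ Ioc p q | ¬ z (t - 1) < z t} ≤
        #{t ∈ {t ∈ Ioc 0 d | ¬ z (t - 1) < z t} | p < t ∧ t ≤ q} := card_le_card fun t ht => by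
      simp only [mem_filter, mem_Ioc] at ht ⊢
      omega
    omega
  obtain ⟨g, hg, hgt⟩ := key τ {t ∈ Ioc 0 d | ¬ z (t - 1) < z t}
    (hcompl τ fun p q => by simp only [oadWeight]; omega)
  obtain ⟨g', hg', hgt'⟩ := key σ {t ∈ Ioc 0 d | ¬ z (t - 1) < z t}
    (hcompl σ fun p q => by simp only [oadWeight]; omega)
  simp only [mem_filter] at hft hgt hgt'
  refine ⟨fun j => if τ j = 0 then g j else if σ j = 0 then g' j else f j, fun j hj => ?_,
    fun j hj k hk hjk he => ?_⟩
  · have := hft j hj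
    have := hgt j hj
    have := hgt' j hj
    have := h.left_le j hj
    have := h.right_le j hj
    simp only
    split_ifs <;> omega
  · have := h.left_le j hj
    have := h.right_le j hj
    have := h.left_le k hk
    have := h.right_le k hk
    have hfj := hft j hj
    have hgj := hgt j hj
    have hgj' := hgt' j hj
    have hfk := hft k hk
    have hgk := hgt k hk
    have hgk' := hgt' k hk
    have hf := hf j hj
    have hg := hg j hj
    have hg' := hg' j hj
    have hf := fun h₁ => hf h₁ k hk
    have hg := fun h₁ => hg h₁ k hk
    have hg' := fun h₁ => hg' h₁ k hk
    simp only at he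
    have hcj := h.cover j hj
    have hck := h.cover k hk
    -- Two variables of the same class differ by injectivity of its matching. A variable of S ∩ T
    -- and one outside it differ because one value is a jump of `z` and the other is not. Variables
    -- of S \ T and T \ S may agree, since no common set contains them.
    split_ifs at he with c₁ c₂ c₃ c₄ c₅ c₆ c₇ c₈
    · exact absurd (hg c₁ c₂ he) hjk
    · omega
    · exfalso
      have a₁ := (hgj c₁).1.2
      have a₂ := (hfk (by omega)).1.2
      rw [he] at a₁
      exact a₁ a₂
    · omega
    · exact absurd (hg' (by assumption) (by assumption) he) hjk
    · exfalso
      have a₁ := (hgj' (by assumption)).1.2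
      have a₂ := (hfk (by omega)).1.2
      rw [he] at a₁
      exact a₁ a₂
    · exfalso
      have a₁ := (hgk (by assumption)).1.2
      have a₂ := (hfj (by omega)).1.2
      rw [he] at a₂
      exact a₁ a₂
    · exfalso
      have a₁ := (hgk' (by assumption)).1.2
      have a₂ := (hfj (by omega)).1.2
      rw [he] at a₂
      exact a₁ a₂
    · exact absurd (hf (by omega) (by omega) he) hjk

end

end

/-! ### The program -/

namespace WordRAM

open Cmd

/-- The variables of the program. -/
inductive OadVar where
  | res | n | d | i | hi | v | lo | fail | b | k | x | y | j | cC | cA | cB | p | q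
deriving DecidableEq

/-- Line `4 * e + c` of the input. -/
def cell (e : Arith OadVar) (c : ℕ) : Arith OadVar := .add (.mul (.lit 4) e) (.lit c)

/-- The address of the label of the node `e`. -/
def labelAddr (e : Arith OadVar) : Arith OadVar := .add (cell (.var .n) 2) e

/-- The address of the mark of the node `e`. -/
def markAddr (e : Arith OadVar) : Arith OadVar :=
  .add (cell (.var .n) 2) (.add (.add (.var .d) (.lit 1)) e)

/-- The address of the weight of the pair of nodes `a`, `b`. -/
def weightAddr (a b : Arith OadVar) : Arith OadVar :=
  .add (cell (.var .n) 2) (.add (.mul (.add (.var .d) (.lit 1)) (.lit 2))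
    (.add (.mul a (.add (.var .d) (.lit 1))) b))

/-- The number of nodes. -/
def numNodes : Arith OadVar := .add (.var .d) (.lit 1)

/-- `1` if `e` is `0` and `[l j, u j]` is contained in `(a, b]`, else `0`. -/
def containedBit (e a b : Arith OadVar) : Arith OadVar :=
  .sub (.lit 1) (.add (.add e (.sub (.add a (.lit 1)) (.load (cell (.var .j) 2))))
    (.sub (.load (cell (.var .j) 3)) b))

/-- Add up the three interval counts for the pair `x`, `y`. -/
def countCmd : Cmd OadVar :=
  seq (assign .cC (.add (.var .cC) (containedBit (.add (.sub (.lit 1) (.load (cell (.var .j) 4)))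
      (.sub (.lit 1) (.load (cell (.var .j) 5)))) (.var .x) (.var .y))))
    (seq (assign .cA (.add (.var .cA)
        (containedBit (.load (cell (.var .j) 5)) (.var .y) (.var .x))))
      (assign .cB (.add (.var .cB)
        (containedBit (.load (cell (.var .j) 4)) (.var .y) (.var .x)))))

/-- Compute the weight of the pair `x`, `y`. -/
def weightCmd : Cmd OadVar :=
  seq (assign .cC (.lit 0)) (seq (assign .cA (.lit 0)) (seq (assign .cB (.lit 0))
    (seq (forRange .j (.var .n) countCmd)
      (seq (assign .cA (.add (.var .cA) (.sub (.var .cB) (.var .cA))))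
        (store (weightAddr (.var .x) (.var .y))
          (.add (.var .cC) (.sub (.var .cA) (.var .cC))))))))

/-- Compute the weights of all pairs that contain the node `b`. -/
def refreshCmd : Cmd OadVar :=
  forRange .k numNodes (seq (assign .x (.var .k)) (seq (assign .y (.var .b)) (seq weightCmd
    (seq (assign .x (.var .b)) (seq (assign .y (.var .k)) weightCmd)))))

/-- Compute all weights. -/
def buildCmd : Cmd OadVar := forRange .b numNodes refreshCmd

/-- Set all labels and marks to `0`. -/
def initCmd : Cmd OadVar :=
  forRange .q numNodes (seq (store (labelAddr (.var .q)) (.lit 0))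
    (store (markAddr (.var .q)) (.lit 0)))

/-- Set each mark to the label. -/
def markCmd : Cmd OadVar :=
  forRange .q numNodes (store (markAddr (.var .q)) (.load (labelAddr (.var .q))))

/-- Set `p` to a node whose mark is at most its label, or to `d + 1`. -/
def scanCmd : Cmd OadVar :=
  seq (assign .p numNodes) (forRange .q numNodes
    (ite (.load (labelAddr (.var .q))) (.load (markAddr (.var .q))) skip (assign .p (.var .q))))

/-- Raise the labels according to the constraints that start at `p`. -/
def relaxCmd : Cmd OadVar :=
  forRange .q numNodes (store (labelAddr (.var .q)) (.add (.load (labelAddr (.var .q)))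
    (.sub (.sub (.add (.load (labelAddr (.var .p))) (.load (weightAddr (.var .p) (.var .q))))
      (.sub (.var .p) (.var .q))) (.load (labelAddr (.var .q))))))

/-- Compute the least labels satisfying all constraints, or set `fail`. -/
def closureCmd : Cmd OadVar :=
  seq (assign .p (.lit 0)) (loop (.var .p) numNodes (seq scanCmd
    (ite (.var .p) numNodes
      (ite (.var .p) (.load (labelAddr (.var .p)))
        (seq (assign .fail (.lit 1)) (assign .p numNodes))
        (seq (store (markAddr (.var .p)) (.add (.load (labelAddr (.var .p))) (.lit 1))) relaxCmd))
      skip)))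

/-- Decrease the upper bound of the variable `i`, and stop if this makes the instance
unsatisfiable. -/
def lowerCmd : Cmd OadVar :=
  seq (assign .v (.sub (.var .v) (.lit 1))) (seq (store (cell (.var .i) 3) (.var .v))
    (seq (assign .b (.var .v)) (seq refreshCmd (seq markCmd (seq closureCmd
      (ite (.var .fail) (.lit 1) skip
        (seq (assign .v (.add (.var .v) (.lit 1))) (assign .lo (.var .v)))))))))

/-- Replace the lower bound of the variable `i` by its least value in a solution. -/
def tightenCmd : Cmd OadVar :=
  seq (assign .hi (.load (cell (.var .i) 3))) (seq (assign .v (.add (.var .hi) (.lit 1)))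
    (seq (assign .lo (.load (cell (.var .i) 2))) (seq (assign .fail (.lit 0))
      (seq buildCmd (seq initCmd (seq (loop (.var .lo) (.var .v) lowerCmd)
        (seq (store (cell (.var .i) 3) (.var .hi))
          (ite (.var .hi) (.var .v) (assign .res (.lit 0))
            (store (cell (.var .i) 2) (.var .v))))))))))

/-- Replace every value `t` by `d + 1 - t`. -/
def reflectCmd : Cmd OadVar :=
  forRange .i (.var .n) (seq (assign .x (.load (cell (.var .i) 2)))
    (seq (store (cell (.var .i) 2) (.sub numNodes (.load (cell (.var .i) 3))))
      (store (cell (.var .i) 3) (.sub numNodes (.var .x)))))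

/-- Tighten all lower bounds and reflect. -/
def passCmd : Cmd OadVar := seq (forRange .i (.var .n) tightenCmd) reflectCmd

/-- Enforce bound consistency. -/
def oadCmd : Cmd OadVar :=
  seq (assign .n (.load (.lit 0))) (seq (assign .d (.load (.lit 1)))
    (ite (.add (.var .d) (.var .d)) (.var .n) skip
      (seq (assign .res (.lit 1)) (seq passCmd passCmd))))

/-! ### Memory layout and frames -/

/-- The memory `M` holds the instance, the labels `z`, the marks `y`, and the weights `w`. -/
structure Layout (n d : ℕ) (M l u σ τ z y : ℕ → ℕ) (w : ℕ → ℕ → ℕ) : Prop where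
  l : ∀ j < n, M (4 * j + 2) = l j
  u : ∀ j < n, M (4 * j + 3) = u j
  σ : ∀ j < n, M (4 * j + 4) = σ j
  τ : ∀ j < n, M (4 * j + 5) = τ j
  z : ∀ q ≤ d, M (4 * n + 2 + q) = z q
  y : ∀ q ≤ d, M (4 * n + 2 + (d + 1 + q)) = y q
  w : ∀ p ≤ d, ∀ q ≤ d, M (4 * n + 2 + ((d + 1) * 2 + (p * (d + 1) + q))) = w p q

theorem pair_index_inj {d p q p' q' : ℕ} (hq : q ≤ d) (hq' : q' ≤ d)
    (h : p * (d + 1) + q = p' * (d + 1) + q') : p = p' ∧ q = q' := by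
  have h₁ : ∀ a b, b ≤ d → (a * (d + 1) + b) / (d + 1) = a := fun a b hb => by
    rw [mul_comm, Nat.mul_add_div (by omega), Nat.div_eq_of_lt (by omega), add_zero]
  have : p = p' := by rw [← h₁ p q hq, h, h₁ p' q' hq']
  subst this
  exact ⟨rfl, by omega⟩

theorem pair_index_le {d p q : ℕ} (hp : p ≤ d) (hq : q ≤ d) :
    p * (d + 1) ≤ (d + 1) * (d + 1) ∧ p * (d + 1) + q ≤ (d + 1) * (d + 1) := by
  have : p * (d + 1) ≤ d * (d + 1) := Nat.mul_le_mul_right _ hp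
  rw [add_mul d 1]
  omega

namespace Layout

variable {n d : ℕ} {M l u σ τ z y : ℕ → ℕ} {w : ℕ → ℕ → ℕ}

theorem setL (h : Layout n d M l u σ τ z y w) {i : ℕ} (hi : i < n) (c : ℕ) :
    Layout n d (Function.update M (4 * i + 2) c) (Function.update l i c) u σ τ z y w := by
  constructor
  · intro j hj
    simp only [Function.update_apply, h.l j hj]
    congr 1
    exact propext (by omega)
  all_goals intros; rw [Function.update_of_ne (by omega)]
  exacts [h.u _ ‹_›, h.σ _ ‹_›, h.τ _ ‹_›, h.z _ ‹_›, h.y _ ‹_›, h.w _ ‹_› _ ‹_›]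

theorem setU (h : Layout n d M l u σ τ z y w) {i : ℕ} (hi : i < n) (c : ℕ) :
    Layout n d (Function.update M (4 * i + 3) c) l (Function.update u i c) σ τ z y w := by
  constructor
  case u =>
    intro j hj
    simp only [Function.update_apply, h.u j hj]
    congr 1
    exact propext (by omega)
  all_goals intros; rw [Function.update_of_ne (by omega)]
  exacts [h.l _ ‹_›, h.σ _ ‹_›, h.τ _ ‹_›, h.z _ ‹_›, h.y _ ‹_›, h.w _ ‹_› _ ‹_›]

theorem setZ (h : Layout n d M l u σ τ z y w) {q : ℕ} (hq : q ≤ d) (c : ℕ) :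
    Layout n d (Function.update M (4 * n + 2 + q) c) l u σ τ (Function.update z q c) y w := by
  constructor
  case z =>
    intro j hj
    simp only [Function.update_apply, h.z j hj]
    congr 1
    exact propext (by omega)
  all_goals intros; rw [Function.update_of_ne (by omega)]
  exacts [h.l _ ‹_›, h.u _ ‹_›, h.σ _ ‹_›, h.τ _ ‹_›, h.y _ ‹_›, h.w _ ‹_› _ ‹_›]

theorem setY (h : Layout n d M l u σ τ z y w) {q : ℕ} (hq : q ≤ d) (c : ℕ) :
    Layout n d (Function.update M (4 * n + 2 + (d + 1 + q)) c) l u σ τ z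
      (Function.update y q c) w := by
  constructor
  case y =>
    intro j hj
    simp only [Function.update_apply, h.y j hj]
    congr 1
    exact propext (by omega)
  all_goals intros; rw [Function.update_of_ne (by omega)]
  exacts [h.l _ ‹_›, h.u _ ‹_›, h.σ _ ‹_›, h.τ _ ‹_›, h.z _ ‹_›, h.w _ ‹_› _ ‹_›]

theorem setW (h : Layout n d M l u σ τ z y w) {p q : ℕ} (hq : q ≤ d) (c : ℕ) :
    Layout n d (Function.update M (4 * n + 2 + ((d + 1) * 2 + (p * (d + 1) + q))) c) l u σ τ z y
      (Function.update w p (Function.update (w p) q c)) := by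
  constructor
  case w =>
    intro p' hp' q' hq'
    have : 4 * n + 2 + ((d + 1) * 2 + (p' * (d + 1) + q')) =
        4 * n + 2 + ((d + 1) * 2 + (p * (d + 1) + q)) ↔ p' = p ∧ q' = q :=
      ⟨fun e => pair_index_inj hq' hq (by omega), fun ⟨h₁, h₂⟩ => by rw [h₁, h₂]⟩
    simp only [Function.update_apply, this, h.w p' hp' q' hq']
    by_cases h₁ : p' = p <;> by_cases h₂ : q' = q <;> simp [h₁, h₂]
  all_goals intros; rw [Function.update_of_ne (by omega)]
  exacts [h.l _ ‹_›, h.u _ ‹_›, h.σ _ ‹_›, h.τ _ ‹_›, h.z _ ‹_›, h.y _ ‹_›]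

theorem congr_w (h : Layout n d M l u σ τ z y w) {w' : ℕ → ℕ → ℕ}
    (hw : ∀ p ≤ d, ∀ q ≤ d, w p q = w' p q) : Layout n d M l u σ τ z y w' :=
  ⟨h.l, h.u, h.σ, h.τ, h.z, h.y, fun p hp q hq => (h.w p hp q hq).trans (hw p hp q hq)⟩

end Layout

/-- Only the variables in `X` differ. -/
def Frame (X : List OadVar) (f g : OadVar → ℕ) : Prop := ∀ r, r ∉ X → g r = f r

theorem Frame.refl (X : List OadVar) (f : OadVar → ℕ) : Frame X f f := fun _ _ => rfl

theorem Frame.update {X : List OadVar} {f g : OadVar → ℕ} (h : Frame X f g) {r : OadVar}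
    (hr : r ∈ X) (c : ℕ) : Frame X f (Function.update g r c) := fun r' hr' => by
  rw [Function.update_of_ne (by rintro rfl; exact hr' hr), h r' hr']

theorem Frame.trans {X Y : List OadVar} {f g g' : OadVar → ℕ} (h : Frame X f g)
    (h' : Frame Y g g') (hYX : Y ⊆ X) : Frame X f g' := fun r hr =>
  (h' r (fun hr' => hr (hYX hr'))).trans (h r hr)

variable {B n d : ℕ} {l u σ τ z y : ℕ → ℕ} {w : ℕ → ℕ → ℕ}

/-- The bound in `hB` covers the addresses of the weight table, the last block of the memory. The
maximum in the weight is computed as a + (b - a) with truncated subtraction. -/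
theorem wp_weightCmd (hB : 4 * n + 4 * d + (d + 1) * (d + 1) + 20 ≤ B)
    (hI : OadInstance n d l u σ τ) {s : St OadVar} (hn : s.var .n = n) (hd : s.var .d = d)
    {a b : ℕ} (hx : s.var .x = a) (hy : s.var .y = b) (ha : a ≤ d) (hb : b ≤ d)
    (L : Layout n d s.mem l u σ τ z y w) :
    wp B weightCmd (fun s' => s'.time ≤ s.time + (300 * n + 100) ∧
      Frame [.j, .cC, .cA, .cB] s.var s'.var ∧ Layout n d s'.mem l u σ τ z y
        (Function.update w a (Function.update (w a) b (oadWeight n l u σ τ a b)))) s := by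
  refine wp_seq (wp_assign (by simp) (wp_seq (wp_assign (by simp) (wp_seq
    (wp_assign (by simp) (wp_seq ?_))))))
  refine wp.mono (wp_forRange (m := n) (K := 200) (by omega) (by omega) (fun k f M =>
    k ≤ n ∧ M = s.mem ∧ f .j = k ∧ Frame [.j, .cC, .cA, .cB] s.var f ∧
    f .cC = intervalCount (fun j => 1 - σ j + (1 - τ j)) l u k a b ∧
    f .cA = intervalCount τ l u k b a ∧ f .cB = intervalCount σ l u k b a) ?_ ?_ ?_) ?_
  · rintro k f M ⟨-, -, hj, hf, -⟩
    exact ⟨hj, by simp [hf .n, hn], trivial⟩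
  · rintro k hk s' ⟨-, hM, hj, hf, hC, hA, hB'⟩
    have fx := hf .x (by simp)
    have fy := hf .y (by simp)
    rw [hx] at fx
    rw [hy] at fy
    have hl := L.l k hk
    have hu := L.u k hk
    have hσ := L.σ k hk
    have hτ := L.τ k hk
    have := hI.one_le k hk
    have := hI.le k hk
    have := hI.le_d k hk
    have := hI.left_le k hk
    have := hI.right_le k hk
    have hCn := intervalCount_le (fun j => 1 - σ j + (1 - τ j)) l u k a b
    have hAn := intervalCount_le τ l u k b a
    have hBn := intervalCount_le σ l u k b a
    refine wp_seq (wp_assign ?_ (wp_seq (wp_assign ?_ (wp_assign ?_ ⟨?_, ?_, ?_⟩))))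
    · simp [containedBit, cell, hM, hj, fx, fy, hC, hl, hu, hσ, hτ]
      omega
    · simp [containedBit, cell, hM, hj, fx, fy, hA, hl, hu, hσ, hτ]
      omega
    · simp [containedBit, cell, hM, hj, fx, fy, hB', hl, hu, hσ, hτ]
      omega
    · simp [containedBit, cell]
    · simp [hj]
    · refine ⟨hk, hM, by simp, ?_, ?_, ?_, ?_⟩
      · exact (((hf.update (by simp) _).update (by simp) _).update (by simp) _).update (by simp) _
      · simp [containedBit, cell, hM, hj, fx, fy, hC, hl, hu, hσ, hτ, intervalCount,
          Finset.sum_range_succ]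
      · simp [containedBit, cell, hM, hj, fx, fy, hA, hl, hu, hσ, hτ, intervalCount,
          Finset.sum_range_succ]
      · simp [containedBit, cell, hM, hj, fx, fy, hB', hl, hu, hσ, hτ, intervalCount,
          Finset.sum_range_succ]
  · refine ⟨Nat.zero_le _, rfl, by simp, ?_, by simp [intervalCount], by simp [intervalCount],
      by simp [intervalCount]⟩
    exact ((((Frame.refl _ _).update (by simp) _).update (by simp) _).update (by simp) _).update
      (by simp) _
  · rintro s' - ⟨⟨-, hM, hj, hf, hC, hA, hB'⟩, ht⟩
    have fx := hf .x (by simp)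
    have fy := hf .y (by simp)
    have fn := hf .n (by simp)
    have fd := hf .d (by simp)
    rw [hx] at fx
    rw [hy] at fy
    rw [hn] at fn
    rw [hd] at fd
    have hCn := intervalCount_le (fun j => 1 - σ j + (1 - τ j)) l u n a b
    have hAn := intervalCount_le τ l u n b a
    have hBn := intervalCount_le σ l u n b a
    have := pair_index_le ha hb
    refine wp_seq (wp_assign ?_ (wp_store ?_ ?_ ⟨?_, ?_, ?_⟩))
    · simp [hA, hB']
      omega
    · simp [weightAddr, cell, fx, fy, fn, fd]
      omega
    · simp [hA, hB', hC]
      omega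
    · simp [weightAddr, cell] at ht ⊢
      omega
    · exact hf.update (by simp) _
    · have := L.setW (p := a) hb (oadWeight n l u σ τ a b)
      rw [← hM] at this
      convert this using 2
      · simp [weightAddr, cell, fx, fy, fn, fd]
      · simp [hA, hB', hC, oadWeight]
        omega

/-! ### Time and effect of the subroutines -/

theorem wp_refreshCmd (hB : 4 * n + 4 * d + (d + 1) * (d + 1) + 20 ≤ B)
    (hI : OadInstance n d l u σ τ) {s : St OadVar} (hn : s.var .n = n) (hd : s.var .d = d)
    {b : ℕ} (hb : s.var .b = b) (hbd : b ≤ d) (L : Layout n d s.mem l u σ τ z y w) :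
    wp B refreshCmd (fun s' => s'.time ≤ s.time + (d + 1) * (600 * n + 250) ∧
      Frame [.k, .x, .y, .j, .cC, .cA, .cB] s.var s'.var ∧ Layout n d s'.mem l u σ τ z y
        (fun p q => if p = b ∨ q = b then oadWeight n l u σ τ p q else w p q)) s := by
  refine wp.mono (wp_forRange (m := d + 1) (K := 600 * n + 210) (by omega) (by omega)
    (fun k f M => f .k = k ∧ Frame [.k, .x, .y, .j, .cC, .cA, .cB] s.var f ∧
      Layout n d M l u σ τ z y (fun p q => if (p = b ∧ q < k) ∨ (q = b ∧ p < k) then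
        oadWeight n l u σ τ p q else w p q)) ?_ ?_ ?_) ?_
  · rintro k f M ⟨hk, hf, -⟩
    have fd := hf .d (by simp)
    simp [hk, numNodes, fd, hd]
    omega
  · rintro k hk s₁ ⟨hk₁, hf, L₁⟩
    have fn := hf .n (by simp)
    have fd := hf .d (by simp)
    have fb := hf .b (by simp)
    rw [hn] at fn
    rw [hd] at fd
    rw [hb] at fb
    refine wp_seq (wp_assign trivial (wp_seq (wp_assign trivial (wp_seq ?_))))
    refine wp.mono (wp_weightCmd (a := k) (b := b) hB hI (by simp [fn]) (by simp [fd])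
      (by simp [hk₁]) (by simp [fb]) (by omega) hbd L₁) ?_
    rintro s₂ - ⟨t₂, f₂, L₂⟩
    have fn₂ := f₂ .n (by simp)
    have fd₂ := f₂ .d (by simp)
    have fb₂ := f₂ .b (by simp)
    have fk₂ := f₂ .k (by simp)
    simp [fn, fd, fb, hk₁] at fn₂ fd₂ fb₂ fk₂
    refine wp_seq (wp_assign trivial (wp_seq (wp_assign trivial ?_)))
    refine wp.mono (wp_weightCmd (a := b) (b := k) hB hI (by simp [fn₂]) (by simp [fd₂])
      (by simp [fb₂]) (by simp [fk₂]) hbd (by omega) L₂) ?_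
    rintro s₃ - ⟨t₃, f₃, L₃⟩
    have fk₃ := f₃ .k (by simp)
    simp [fk₂] at fk₃
    refine ⟨?_, fk₃, by simp, Frame.update ?_ (by simp) _, L₃.congr_w fun p hp q hq => ?_⟩
    · simp at t₂ t₃
      omega
    · exact (((((hf.update (by simp) _).update (by simp) _).trans f₂ (by simp)).update
        (by simp) _).update (by simp) _).trans f₃ (by simp)
    · simp only [Function.update_apply]
      grind
  · refine ⟨by simp, (Frame.refl _ _).update (by simp) _, by simpa using L⟩
  · rintro s' - ⟨⟨-, hf, L'⟩, ht⟩
    refine ⟨?_, hf, L'.congr_w fun p hp q hq => ?_⟩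
    · simp only [numNodes, Arith.cost] at ht
      nlinarith
    · congr 1
      exact propext (by omega)

theorem wp_buildCmd (hB : 4 * n + 4 * d + (d + 1) * (d + 1) + 20 ≤ B)
    (hI : OadInstance n d l u σ τ) {s : St OadVar} (hn : s.var .n = n) (hd : s.var .d = d)
    (L : Layout n d s.mem l u σ τ z y w) :
    wp B buildCmd (fun s' => s'.time ≤ s.time + (d + 1) * ((d + 1) * (600 * n + 250) + 30) ∧
      Frame [.b, .k, .x, .y, .j, .cC, .cA, .cB] s.var s'.var ∧
      Layout n d s'.mem l u σ τ z y (oadWeight n l u σ τ)) s := by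
  refine wp.mono (wp_forRange (m := d + 1) (K := (d + 1) * (600 * n + 250)) (by omega) (by omega)
    (fun k f M => f .b = k ∧ Frame [.b, .k, .x, .y, .j, .cC, .cA, .cB] s.var f ∧
      ∃ w, Layout n d M l u σ τ z y w ∧ ∀ p q, q < k → w p q = oadWeight n l u σ τ p q)
      ?_ ?_ ?_) ?_
  · rintro k f M ⟨hk, hf, -⟩
    have fd := hf .d (by simp)
    simp [hk, numNodes, fd, hd]
    omega
  · rintro k hk s₁ ⟨hk₁, hf, w₁, L₁, hw₁⟩
    refine wp.mono (wp_refreshCmd hB hI ((hf .n (by simp)).trans hn) ((hf .d (by simp)).trans hd)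
      hk₁ (by omega) L₁) ?_
    rintro s₂ - ⟨t₂, f₂, L₂⟩
    refine ⟨t₂, (f₂ .b (by simp)).trans hk₁, by simp, Frame.update (hf.trans f₂ (by simp))
      (by simp) _, _, L₂, fun p q hq => ?_⟩
    simp only [ite_eq_left_iff]
    exact fun h => hw₁ _ _ (by omega)
  · exact ⟨by simp, (Frame.refl _ _).update (by simp) _, w, L, by simp⟩
  · rintro s' - ⟨⟨-, hf, w', L', hw'⟩, ht⟩
    refine ⟨?_, hf, L'.congr_w fun p hp q hq => hw' p q (by omega)⟩
    simp only [numNodes, Arith.cost] at ht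
    nlinarith

theorem wp_initCmd (hB : 4 * n + 4 * d + (d + 1) * (d + 1) + 20 ≤ B)
    {s : St OadVar} (hn : s.var .n = n) (hd : s.var .d = d)
    (L : Layout n d s.mem l u σ τ z y w) :
    wp B initCmd (fun s' => s'.time ≤ s.time + (d + 1) * 100 ∧
      Frame [.q] s.var s'.var ∧ Layout n d s'.mem l u σ τ 0 0 w) s := by
  refine wp.mono (wp_forRange (m := d + 1) (K := 50) (by omega) (by omega)
    (fun k f M => f .q = k ∧ Frame [.q] s.var f ∧
      ∃ z y, Layout n d M l u σ τ z y w ∧ ∀ q < k, z q = 0 ∧ y q = 0) ?_ ?_ ?_) ?_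
  · rintro k f M ⟨hk, hf, -⟩
    have fd := hf .d (by simp)
    simp [hk, numNodes, fd, hd]
    omega
  · rintro k hk s₁ ⟨hk₁, hf, z₁, y₁, L₁, h₁⟩
    have fn := hf .n (by simp)
    have fd := hf .d (by simp)
    rw [hn] at fn
    rw [hd] at fd
    refine wp_seq (wp_store ?_ (by simp) (wp_store ?_ (by simp) ⟨?_, hk₁, by simp,
      hf.update (by simp) _, Function.update z₁ k 0, Function.update y₁ k 0, ?_, ?_⟩))
    · simp [labelAddr, cell, fn, hk₁]
      omega
    · simp [markAddr, cell, fn, fd, hk₁]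
      omega
    · simp [labelAddr, markAddr, cell]
    · have := (L₁.setZ (q := k) (by omega) 0).setY (q := k) (by omega) 0
      simpa [labelAddr, markAddr, cell, fn, fd, hk₁] using this
    · intro q hq
      have := h₁ q
      simp only [Function.update_apply]
      split_ifs
      · simp
      · exact this (by omega)
  · exact ⟨by simp, (Frame.refl _ _).update (by simp) _, z, y, L, by simp⟩
  · rintro s' - ⟨⟨-, hf, z', y', L', h'⟩, ht⟩
    refine ⟨?_, hf, ⟨L'.l, L'.u, L'.σ, L'.τ, fun q hq => ?_, fun q hq => ?_, L'.w⟩⟩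
    · simp only [numNodes, Arith.cost] at ht
      omega
    · rw [L'.z q hq, (h' q (by omega)).1, Pi.zero_apply]
    · rw [L'.y q hq, (h' q (by omega)).2, Pi.zero_apply]

theorem wp_markCmd (hB : 4 * n + 4 * d + (d + 1) * (d + 1) + 20 ≤ B)
    {s : St OadVar} (hn : s.var .n = n) (hd : s.var .d = d)
    (L : Layout n d s.mem l u σ τ z y w) :
    wp B markCmd (fun s' => s'.time ≤ s.time + (d + 1) * 100 ∧
      Frame [.q] s.var s'.var ∧ Layout n d s'.mem l u σ τ z z w) s := by
  refine wp.mono (wp_forRange (m := d + 1) (K := 50) (by omega) (by omega)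
    (fun k f M => f .q = k ∧ Frame [.q] s.var f ∧
      ∃ y, Layout n d M l u σ τ z y w ∧ ∀ q < k, y q = z q) ?_ ?_ ?_) ?_
  · rintro k f M ⟨hk, hf, -⟩
    have fd := hf .d (by simp)
    simp [hk, numNodes, fd, hd]
    omega
  · rintro k hk s₁ ⟨hk₁, hf, y₁, L₁, h₁⟩
    have fn := hf .n (by simp)
    have fd := hf .d (by simp)
    rw [hn] at fn
    rw [hd] at fd
    have hz := L₁.z k (by omega)
    refine wp_store ?_ ?_ ⟨?_, hk₁, by simp,
      hf.update (by simp) _, Function.update y₁ k (z k), ?_, ?_⟩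
    · simp [markAddr, cell, fn, fd, hk₁]
      omega
    · simp [labelAddr, cell, fn, hk₁]
      omega
    · simp [labelAddr, markAddr, cell]
    · have := L₁.setY (q := k) (by omega) (z k)
      simpa [labelAddr, markAddr, cell, fn, fd, hk₁, hz] using this
    · intro q hq
      have := h₁ q
      simp only [Function.update_apply]
      split_ifs with h
      · rw [h]
      · exact this (by omega)
  · exact ⟨by simp, (Frame.refl _ _).update (by simp) _, y, L, by simp⟩
  · rintro s' - ⟨⟨-, hf, y', L', h'⟩, ht⟩
    refine ⟨?_, hf, ⟨L'.l, L'.u, L'.σ, L'.τ, L'.z, fun q hq => ?_, L'.w⟩⟩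
    · simp only [numNodes, Arith.cost] at ht
      omega
    · rw [L'.y q hq, h' q (by omega)]

theorem wp_scanCmd (hB : 4 * n + 4 * d + (d + 1) * (d + 1) + 20 ≤ B)
    {s : St OadVar} (hn : s.var .n = n) (hd : s.var .d = d)
    (L : Layout n d s.mem l u σ τ z y w) :
    wp B scanCmd (fun s' => s'.time ≤ s.time + (d + 1) * 100 ∧
      Frame [.p, .q] s.var s'.var ∧ s'.mem = s.mem ∧
      ((s'.var .p = d + 1 ∧ ∀ q ≤ d, z q < y q) ∨
        ∃ p ≤ d, s'.var .p = p ∧ y p ≤ z p)) s := by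
  refine wp_seq (wp_assign ?_ ?_)
  · simp [numNodes, hd]
    omega
  refine wp.mono (wp_forRange (m := d + 1) (K := 50) (by omega) (by omega)
    (fun k f M => f .q = k ∧ Frame [.p, .q] s.var f ∧ M = s.mem ∧
      ((f .p = d + 1 ∧ ∀ q < k, z q < y q) ∨ ∃ p ≤ d, f .p = p ∧ y p ≤ z p)) ?_ ?_ ?_) ?_
  · rintro k f M ⟨hk, hf, -⟩
    have fd := hf .d (by simp)
    simp [hk, numNodes, fd, hd]
    omega
  · rintro k hk s₁ ⟨hk₁, hf, hM, h₁⟩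
    have fn := hf .n (by simp)
    have fd := hf .d (by simp)
    rw [hn] at fn
    rw [hd] at fd
    have hz := L.z k (by omega)
    have hy := L.y k (by omega)
    refine wp_ite ?_ ?_ (fun hlt => wp_skip ⟨?_, hk₁, by simp, hf.update (by simp) _, hM, ?_⟩)
      (fun hle => wp_assign trivial ⟨?_, ?_, by simp, (hf.update (by simp) _).update (by simp) _,
        hM, Or.inr ⟨k, by omega, ?_, ?_⟩⟩)
    · simp [labelAddr, cell, fn, hk₁]
      omega
    · simp [markAddr, cell, fn, fd, hk₁]
      omega
    · simp [labelAddr, markAddr, cell]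
    · simp [labelAddr, markAddr, cell, fn, fd, hk₁, hM, hz, hy] at hlt
      refine h₁.imp (fun h => ⟨by simpa using h.1, fun q hq => ?_⟩)
        (fun ⟨p, hp, h⟩ => ⟨p, hp, by simpa using h⟩)
      rcases Nat.lt_succ_iff_lt_or_eq.1 hq with hq | rfl
      · exact h.2 q hq
      · exact hlt
    · simp [labelAddr, markAddr, cell]
    · simp [hk₁]
    · simp [hk₁]
    · simpa [labelAddr, markAddr, cell, fn, fd, hk₁, hM, hz, hy] using hle
  · exact ⟨by simp, ((Frame.refl _ _).update (by simp) _).update (by simp) _, rfl,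
      Or.inl ⟨by simp [numNodes, hd], by simp⟩⟩
  · rintro s' - ⟨⟨-, hf, hM, h'⟩, ht⟩
    refine ⟨?_, hf, hM, h'.imp_left fun h => ⟨h.1, fun q hq => h.2 q (by omega)⟩⟩
    simp only [numNodes, Arith.cost] at ht
    omega

theorem wp_relaxCmd (hB : 4 * n + 4 * d + (d + 1) * (d + 1) + 20 ≤ B)
    {s : St OadVar} (hn : s.var .n = n) (hd : s.var .d = d)
    {p : ℕ} (hp : s.var .p = p) (hpd : p ≤ d) (hw : w p p = 0) (hwn : ∀ q ≤ d, w p q ≤ n)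
    (hz : ∀ q ≤ d, z q ≤ d + n) (hzp : z p ≤ d)
    (L : Layout n d s.mem l u σ τ z y w) :
    wp B relaxCmd (fun s' => s'.time ≤ s.time + (d + 1) * 200 ∧ Frame [.q] s.var s'.var ∧
      Layout n d s'.mem l u σ τ (fun q => max (z q) (z p + w p q - (p - q))) y w) s := by
  refine wp.mono (wp_forRange (m := d + 1) (K := 100) (by omega) (by omega)
    (fun k f M => f .q = k ∧ Frame [.q] s.var f ∧ Layout n d M l u σ τ
      (fun q => if q < k then max (z q) (z p + w p q - (p - q)) else z q) y w) ?_ ?_ ?_) ?_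
  · rintro k f M ⟨hk, hf, -⟩
    have fd := hf .d (by simp)
    simp [hk, numNodes, fd, hd]
    omega
  · rintro k hk s₁ ⟨hk₁, hf, L₁⟩
    have fn := hf .n (by simp)
    have fd := hf .d (by simp)
    have fp := hf .p (by simp)
    rw [hn] at fn
    rw [hd] at fd
    rw [hp] at fp
    have hzk := L₁.z k (by omega)
    have hzp' := L₁.z p hpd
    have hwk := L₁.w p hpd k (by omega)
    -- The update is done in place, and the label of `p` is read in every iteration. Since w(p, p) =
    -- 0, it is the same before and after position p has been processed.
    have e₁ : (if p < k then max (z p) (z p + w p p - (p - p)) else z p) = z p := by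
      rw [hw]
      split_ifs
      · simp
      · rfl
    rw [e₁] at hzp'
    rw [if_neg (lt_irrefl k)] at hzk
    have := pair_index_le hpd (show k ≤ d by omega)
    have := hz k (by omega)
    have := hwn k (by omega)
    refine wp_store ?_ ?_ ⟨?_, hk₁, by simp, hf.update (by simp) _, ?_⟩
    · simp [labelAddr, cell, fn, hk₁]
      omega
    · simp [labelAddr, weightAddr, cell, fn, fd, fp, hk₁, hzk, hzp', hwk]
      omega
    · simp [labelAddr, weightAddr, cell]
    · have := L₁.setZ (q := k) (by omega) (z k + (z p + w p k - (p - k) - z k))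
      simp only [labelAddr, weightAddr, cell, Arith.val, fn, fd, fp, hk₁, hzk, hzp', hwk]
      refine ⟨this.l, this.u, this.σ, this.τ, fun q hq => (this.z q hq).trans ?_, this.y, this.w⟩
      simp only [Function.update_apply]
      split_ifs with h₁ h₂ h₃ h₄
      · subst h₁
        omega
      · omega
      · rfl
      · omega
      · omega
      · rfl
  · exact ⟨by simp, (Frame.refl _ _).update (by simp) _, by simpa using L⟩
  · rintro s' - ⟨⟨-, hf, L'⟩, ht⟩
    refine ⟨?_, hf, ⟨L'.l, L'.u, L'.σ, L'.τ, fun q hq => ?_, L'.y, L'.w⟩⟩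
    · simp only [numNodes, Arith.cost] at ht
      omega
    · rw [L'.z q hq, if_pos (by omega)]

/-! ### Amortised closure of the labels -/

/-- The labels are below every solution of the difference constraints that starts at `0`. -/
def BelowSolutions (d : ℕ) (w : ℕ → ℕ → ℕ) (z : ℕ → ℕ) : Prop :=
  ∀ z', DiffSystem d w z' → z' 0 = 0 → ∀ q ≤ d, z q ≤ z' q

/-- The total amount by which the marks can still be raised. -/
def slack (n d : ℕ) (y : ℕ → ℕ) : ℕ := ∑ q ∈ Finset.range (d + 1), (d + n + 2 - y q)

/-- Processing a node raises its mark above the old one, so the slack serves as the potential that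
pays for one iteration of the closure loop. -/
theorem slack_update_lt {p c : ℕ} (hp : p ≤ d) (hc : y p < c) (hn : y p < d + n + 2) :
    slack n d (Function.update y p c) + 1 ≤ slack n d y := by
  rw [Nat.add_one_le_iff, slack, slack]
  refine Finset.sum_lt_sum (fun q _ => ?_) ⟨p, Finset.mem_range.2 (by omega), ?_⟩
  · simp only [Function.update_apply]
    split_ifs with h
    · subst h
      omega
    · rfl
  · simp only [Function.update_self]
    omega

/-- Resetting the marks to the labels makes every node pending again. As no mark exceeds its label
by more than 1, this returns at most one unit of potential per node. -/
theorem slack_le_add (h : ∀ q ≤ d, y q ≤ z q + 1) : slack n d z ≤ slack n d y + (d + 1) := by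
  have h₁ : ∑ q ∈ Finset.range (d + 1), (d + n + 2 - y q) + (d + 1) =
      ∑ q ∈ Finset.range (d + 1), (d + n + 2 - y q + 1) := by simp [Finset.sum_add_distrib]
  rw [slack, slack, h₁]
  refine Finset.sum_le_sum fun q hq => ?_
  have := h q (by simp at hq; omega)
  omega

theorem BelowSolutions.relax (h : BelowSolutions d w z) {p : ℕ} (hp : p ≤ d) :
    BelowSolutions d w (fun q => max (z q) (z p + w p q - (p - q))) := by
  intro z' hz' h0 q hq
  have h₁ := h z' hz' h0 q hq
  have h₂ := h z' hz' h0 p hp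
  have h₃ := hz' p hp q hq
  simp only
  omega

/-- The constraint from p to 0 forces z'(p) ≤ p when z'(0) = 0, so a lower bound exceeding p is a
refutation. -/
theorem BelowSolutions.not_diffSystem (h : BelowSolutions d w z) {p : ℕ} (hp : p ≤ d)
    (hlt : p < z p) {z' : ℕ → ℕ} (hz' : DiffSystem d w z') : z' 0 ≠ 0 := by
  intro h0
  have h₁ := h z' hz' h0 p hp
  have h₂ := hz' p hp 0 (by omega)
  omega

/-- The cost of one iteration of the closure loop. -/
def closureCost (d : ℕ) : ℕ := (d + 1) * 400

/-- A node is clean if its mark is its label plus 1, and then all constraints starting at it hold.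
The loop processes nodes that are not clean until none is left or a label exceeds its index. The
time estimate keeps the remaining slack on the left, so that unused potential passes on to the next
call. -/
theorem wp_closureCmd (hB : 4 * n + 4 * d + (d + 1) * (d + 1) + 20 ≤ B)
    {s : St OadVar} (hn : s.var .n = n) (hd : s.var .d = d) (hf : s.var .fail = 0)
    (hw : ∀ p ≤ d, w p p = 0) (hwn : ∀ p ≤ d, ∀ q ≤ d, w p q ≤ n)
    (hz : ∀ q ≤ d, z q ≤ d + n) (hzb : BelowSolutions d w z)
    (L : Layout n d s.mem l u σ τ z z w) :
    wp B closureCmd (fun s' => Frame [.p, .q, .fail] s.var s'.var ∧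
      ∃ z' y', Layout n d s'.mem l u σ τ z' y' w ∧ (∀ q ≤ d, z' q ≤ d + n) ∧
        (∀ q ≤ d, y' q ≤ z' q + 1) ∧ BelowSolutions d w z' ∧
        s'.time + closureCost d * slack n d y' ≤
          s.time + closureCost d * (slack n d z + 1) + 20 ∧
        ((s'.var .fail = 0 ∧ DiffSystem d w z') ∨
          (s'.var .fail = 1 ∧ ∀ z', DiffSystem d w z' → z' 0 ≠ 0))) s := by
  refine wp_seq (wp_assign (Nat.zero_le _) ?_)
  refine wp.mono (wp_loop (s.time + closureCost d * (slack n d z + 1) + 2)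
    (fun s' => Frame [.p, .q, .fail] s.var s'.var ∧
      ∃ z' y', Layout n d s'.mem l u σ τ z' y' w ∧ (∀ q ≤ d, z' q ≤ d + n) ∧
        (∀ q ≤ d, y' q ≤ z' q + 1) ∧ BelowSolutions d w z' ∧
        ((s'.var .p ≤ d ∧ s'.var .fail = 0 ∧
            (∀ q ≤ d, y' q = z' q + 1 → ∀ r ≤ d, z' q + w q r ≤ z' r + (q - r)) ∧
            s'.time + closureCost d * (slack n d y' + 1) ≤
              s.time + closureCost d * (slack n d z + 1) + 2) ∨
          (s'.var .p = d + 1 ∧ s'.time + closureCost d * slack n d y' ≤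
              s.time + closureCost d * (slack n d z + 1) + 2 ∧
            ((s'.var .fail = 0 ∧ DiffSystem d w z') ∨
              (s'.var .fail = 1 ∧ ∀ z', DiffSystem d w z' → z' 0 ≠ 0))))) ?_ ?_ ?_ ?_) ?_
  · rintro s' ⟨-, z', y', -, -, -, -, h | h⟩ <;> omega
  · rintro s' ⟨hf, -⟩
    have fd := hf .d (by simp)
    simp [numNodes, fd, hd]
    omega
  · rintro s₁ ⟨hf₁, z₁, y₁, L₁, hz₁, hy₁, hb₁, h₁⟩ hlt
    have fn := hf₁ .n (by simp)
    have fd := hf₁ .d (by simp)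
    rw [hn] at fn
    rw [hd] at fd
    simp only [numNodes, Arith.val, fd] at hlt
    obtain ⟨hp₁, hfail, hclean, ht₁⟩ : _ ∧ _ := h₁.resolve_right (by omega)
    refine wp_seq (wp.mono (wp_scanCmd hB fn fd L₁) ?_)
    rintro s₂ - ⟨t₂, f₂, m₂, h₂⟩
    have fn₂ := (f₂ .n (by simp)).trans fn
    have fd₂ := (f₂ .d (by simp)).trans fd
    have ff₂ := (f₂ .fail (by simp)).trans hfail
    simp only [numNodes, Arith.cost] at t₂
    have hC : closureCost d * (slack n d y₁ + 1) =
      closureCost d * slack n d y₁ + closureCost d := by ring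
    have hC₀ : closureCost d = (d + 1) * 400 := rfl
    refine wp_ite trivial ?_ (fun hlt₂ => ?_) (fun hle₂ => ?_)
    · simp [numNodes, fd₂]
      omega
    · simp only [numNodes, Arith.val, fd₂] at hlt₂
      obtain ⟨p, hpd, hp₂, hyz⟩ := h₂.resolve_left (by omega)
      rw [← m₂] at L₁
      have hzp := L₁.z p hpd
      refine wp_ite trivial ?_ (fun hlt₃ => ?_) (fun hle₃ => ?_)
      · simp [labelAddr, cell, fn₂, hp₂]
        omega
      -- The label of p exceeds p: the system has no solution starting at 0, and p := d + 1 ends the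
      -- loop.
      · simp only [labelAddr, cell, Arith.val, fn₂, hp₂, hzp] at hlt₃
        refine wp_seq (wp_assign ?_ (wp_assign ?_ ⟨?_, z₁, y₁, L₁, hz₁, hy₁, hb₁, Or.inr
          ⟨?_, ?_, Or.inr ⟨?_, fun z' hz' => hb₁.not_diffSystem hpd hlt₃ hz'⟩⟩⟩))
        · simp
          omega
        · simp [numNodes, fd₂]
          omega
        · exact ((hf₁.trans f₂ (by simp)).update (by simp) _).update (by simp) _
        · simp [numNodes, fd₂]
        · simp [numNodes, labelAddr, cell]
          omega
        · simp
      · simp only [labelAddr, cell, Arith.val, fn₂, hp₂, hzp] at hle₃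
        have := hz₁ p hpd
        refine wp_seq (wp_store ?_ ?_ ?_)
        · simp [markAddr, cell, fn₂, fd₂, hp₂]
          omega
        · simp [labelAddr, cell, fn₂, hp₂, hzp]
          omega
        have L₂ := L₁.setY hpd (z₁ p + 1)
        refine wp.mono (wp_relaxCmd (l := l) (u := u) (σ := σ) (τ := τ) (z := z₁)
          (y := Function.update y₁ p (z₁ p + 1)) (w := w) hB (by exact fn₂) (by exact fd₂)
          (by exact hp₂) hpd (hw p hpd) (hwn p hpd) hz₁ (hle₃.trans hpd) ?_) ?_
        · simpa only [labelAddr, markAddr, cell, Arith.val, fn₂, fd₂, hp₂, hzp] using L₂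
        · rintro s₃ - ⟨t₃, f₃, L₃⟩
          refine ⟨(hf₁.trans f₂ (by simp)).trans f₃ (by simp), _, _, L₃, fun q hq => ?_,
            fun q hq => ?_, hb₁.relax hpd,
            Or.inl ⟨?_, (f₃ .fail (by simp)).trans ff₂, fun q hq hyq r hr => ?_, ?_⟩⟩
          -- Relaxation starts only from labels z(p) ≤ p ≤ d and adds at most n, whence the bound d
          -- + n on all labels.
          · have := hz₁ q hq
            have := hwn p hpd q hq
            omega
          · have := hy₁ q hq
            simp only [Function.update_apply]
            split_ifs with h
            · subst h
              omega
            · omega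
          · rw [f₃ .p (by simp)]
            exact hp₂.trans_le hpd
          -- Node p becomes clean by the relaxation itself, its own label being unchanged as w(p, p)
          -- = 0. If another node is clean now, its label was not raised, for its mark was at most
          -- the old label plus 1; its constraints persist as other labels only grow.
          · have h₃ := hw p hpd
            simp only [Function.update_apply] at hyq ⊢
            by_cases h : q = p
            · subst h
              omega
            · rw [if_neg h] at hyq
              have h₄ := hy₁ q hq
              have h₅ := hclean q hq (by omega) r hr
              omega
          · have h₃ := slack_update_lt (n := n) (y := y₁) (p := p) (c := z₁ p + 1) hpd (by omega)
              (by omega)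
            have h₄ := Nat.mul_le_mul_left (closureCost d) h₃
            simp [numNodes, labelAddr, markAddr, cell] at t₃
            omega
    · simp only [numNodes, Arith.val, fd₂] at hle₂
      obtain ⟨hp₂, hcl⟩ := h₂.resolve_right (by rintro ⟨p, hp, h, -⟩; omega)
      refine wp_skip ⟨hf₁.trans f₂ (by simp), z₁, y₁, by rwa [m₂], hz₁, hy₁, hb₁, Or.inr
        ⟨hp₂, ?_, Or.inl ⟨ff₂, fun q hq r hr => hclean q hq ?_ r hr⟩⟩⟩
      · simp [numNodes]
        omega
      · have := hcl q hq
        have := hy₁ q hq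
        omega
  · exact ⟨(Frame.refl _ _).update (by simp) _, z, z, L, hz, fun q _ => Nat.le_succ _, hzb,
      Or.inl ⟨by simp, by simpa using hf, fun q _ h => by omega,
        by simp; omega⟩⟩
  · rintro s' - ⟨s₀, ⟨hf₀, z₀, y₀, L₀, hz₀, hy₀, hb₀, h₀⟩, hle, rfl⟩
    have fd := (hf₀ .d (by simp)).trans hd
    simp only [numNodes, Arith.val, fd] at hle
    obtain ⟨-, ht, h⟩ := h₀.resolve_left (by omega)
    refine ⟨hf₀, z₀, y₀, L₀, hz₀, hy₀, hb₀, ?_, h⟩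
    simp [numNodes]
    omega

/-! ### Lowering one upper bound incrementally -/

theorem _root_.OadInstance.updateU (h : OadInstance n d l u σ τ) {i c : ℕ} (hl : l i ≤ c)
    (hu : c ≤ u i) : OadInstance n d l (Function.update u i c) σ τ := by
  refine ⟨h.one_le, fun j hj => ?_, fun j hj => ?_, h.left_le, h.right_le, h.cover⟩
  · have := h.le j hj
    simp only [Function.update_apply]
    split_ifs with e
    · exact e ▸ hl
    · exact this
  · have := h.le_d j hj
    simp only [Function.update_apply]
    split_ifs with e
    · exact hu.trans (e ▸ this)
    · exact this

/-- Moving an upper end from v + 1 to v alters the test u ≤ q only at q = v. The two nodes exchange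
roles among the three counts, so exactly the pairs containing v need recomputation. -/
theorem oadWeight_update_eq {i c v p q : ℕ} (hc : c = v ∨ c = v + 1) (hp : p ≠ v) (hq : q ≠ v) :
    oadWeight n l (Function.update u i c) σ τ p q =
      oadWeight n l (Function.update u i v) σ τ p q := by
  have key : ∀ (e : ℕ → ℕ) (p q : ℕ), q ≠ v → intervalCount e l (Function.update u i c) n p q =
      intervalCount e l (Function.update u i v) n p q := by
    intro e p q hq
    refine Finset.sum_congr rfl fun j _ => ?_
    simp only [Function.update_apply]
    split_ifs <;> omega
  rw [oadWeight, oadWeight, key _ _ _ hq, key _ _ _ hp, key _ _ _ hp]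

theorem oadWeight_update_mono {i c v p q : ℕ} (hc : v ≤ c) :
    oadWeight n l (Function.update u i c) σ τ p q ≤
      oadWeight n l (Function.update u i v) σ τ p q := by
  have key : ∀ (e : ℕ → ℕ) (p q : ℕ), intervalCount e l (Function.update u i c) n p q ≤
      intervalCount e l (Function.update u i v) n p q := by
    intro e p q
    refine Finset.sum_le_sum fun j _ => ?_
    simp only [Function.update_apply]
    split_ifs <;> omega
  exact max_le_max (key _ _ _) (max_le_max (key _ _ _) (key _ _ _))

theorem BelowSolutions.mono {w' : ℕ → ℕ → ℕ} (h : BelowSolutions d w z)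
    (hw : ∀ p q, w p q ≤ w' p q) : BelowSolutions d w' z := fun z' hz' => h z'
  fun p hp q hq => (Nat.add_le_add_left (hw p q) _).trans (hz' p hp q hq)

/-- The cost of lowering an upper bound by one, up to changes of the slack. -/
def lowerCost (n d : ℕ) : ℕ :=
  (d + 1) * (600 * n + 250) + (d + 1) * 100 + closureCost d * (d + 2) + 200

/-- `c` is the upper bound in memory on entry. It is v + 1 in general, but equals v in the first
call, which tests the unchanged instance. Labels survive because weights grow; the change of slack
on both sides makes the cost amortised over successive calls. -/
theorem wp_lowerCmd (hB : 4 * n + 4 * d + (d + 1) * (d + 1) + 20 ≤ B)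
    (hI : OadInstance n d l u σ τ) {i : ℕ} (hi : i < n) {s : St OadVar} (hn : s.var .n = n)
    (hd : s.var .d = d) (hsi : s.var .i = i) (hf : s.var .fail = 0) {v c : ℕ}
    (hv : s.var .v = v + 1) (hlv : l i ≤ v) (hvu : v ≤ u i) (hc : c = v ∨ c = v + 1)
    (L : Layout n d s.mem l (Function.update u i c) σ τ z y
      (oadWeight n l (Function.update u i c) σ τ))
    (hz : ∀ q ≤ d, z q ≤ d + n) (hy : ∀ q ≤ d, y q ≤ z q + 1)
    (hb : BelowSolutions d (oadWeight n l (Function.update u i c) σ τ) z) :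
    wp B lowerCmd (fun s' =>
      Frame [.v, .lo, .fail, .b, .k, .x, .y, .j, .cC, .cA, .cB, .p, .q] s.var s'.var ∧
      ∃ z' y', Layout n d s'.mem l (Function.update u i v) σ τ z' y'
          (oadWeight n l (Function.update u i v) σ τ) ∧
        (∀ q ≤ d, z' q ≤ d + n) ∧ (∀ q ≤ d, y' q ≤ z' q + 1) ∧
        BelowSolutions d (oadWeight n l (Function.update u i v) σ τ) z' ∧
        s'.time + closureCost d * slack n d y' ≤
          s.time + closureCost d * slack n d y + lowerCost n d ∧
        ((s'.var .v = v ∧ s'.var .lo = s.var .lo ∧ s'.var .fail = 0 ∧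
            ∃ a, OadSolution n l (Function.update u i v) σ τ a) ∨
          (s'.var .v = v + 1 ∧ s'.var .lo = v + 1 ∧
            ¬ ∃ a, OadSolution n l (Function.update u i v) σ τ a))) s := by
  have hvd := hvu.trans (hI.le_d i hi)
  have hI' := hI.updateU hlv hvu
  refine wp_seq (wp_assign (by simp; omega) (wp_seq (wp_store ?_ trivial (wp_seq
    (wp_assign trivial (wp_seq ?_))))))
  · simp [cell, hsi]
    omega
  have L₁ := L.setU hi v
  rw [Function.update_idem] at L₁
  refine wp.mono (wp_refreshCmd (b := v) (z := z) (y := y) (l := l) (u := Function.update u i v)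
    (σ := σ) (τ := τ) (w := oadWeight n l (Function.update u i c) σ τ) hB hI'
    (by simp [hn]) (by simp [hd]) (by simp [hv]) hvd ?_) ?_
  · simpa [cell, hsi, hv] using L₁
  rintro s₂ - ⟨t₂, f₂, L₂⟩
  replace L₂ := L₂.congr_w (w' := oadWeight n l (Function.update u i v) σ τ) fun p hp q hq => by
    split_ifs with h
    · rfl
    · exact oadWeight_update_eq hc (by tauto) (by tauto)
  have fn₂ : s₂.var .n = n := (f₂ .n (by simp)).trans (by simp [hn])
  have fd₂ : s₂.var .d = d := (f₂ .d (by simp)).trans (by simp [hd])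
  have ff₂ : s₂.var .fail = 0 := (f₂ .fail (by simp)).trans (by simp [hf])
  have fv₂ : s₂.var .v = v := (f₂ .v (by simp)).trans (by simp [hv])
  refine wp_seq (wp.mono (wp_markCmd hB fn₂ fd₂ L₂) ?_)
  rintro s₃ - ⟨t₃, f₃, L₃⟩
  refine wp_seq (wp.mono (wp_closureCmd hB ((f₃ .n (by simp)).trans fn₂)
    ((f₃ .d (by simp)).trans fd₂) ((f₃ .fail (by simp)).trans ff₂)
    (fun p _ => oadWeight_self hI'.le p) (fun p _ q _ => oadWeight_le ..) hz
    (hb.mono fun p q => oadWeight_update_mono (by omega)) L₃) ?_)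
  rintro s₄ - ⟨f₄, z', y', L₄, hz', hy', hb', t₄, h₄⟩
  have fr : Frame [.v, .lo, .fail, .b, .k, .x, .y, .j, .cC, .cA, .cB, .p, .q] s.var s₄.var := by
    refine Frame.trans (Frame.trans (Frame.trans (((Frame.refl _ _).update ?_ _).update ?_ _)
      f₂ ?_) f₃ ?_) f₄ ?_ <;> simp
  have fv₄ : s₄.var .v = v := (f₄ .v (by simp)).trans ((f₃ .v (by simp)).trans fv₂)
  have hlo : s₄.var .lo = s.var .lo := (f₄ .lo (by simp)).trans ((f₃ .lo (by simp)).trans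
    ((f₂ .lo (by simp)).trans (by simp)))
  have hsl := Nat.mul_le_mul_left (closureCost d) (slack_le_add (n := n) hy)
  have e₁ : closureCost d * (slack n d z + 1) = closureCost d * slack n d z + closureCost d := by
    ring
  have e₂ : closureCost d * (slack n d y + (d + 1)) + closureCost d =
    closureCost d * slack n d y + closureCost d * (d + 2) := by ring
  have e₃ : lowerCost n d = (d + 1) * (600 * n + 250) + (d + 1) * 100 +
    closureCost d * (d + 2) + 200 := rfl
  simp [cell] at t₂
  refine wp_ite trivial (by simp; omega) (fun hlt => wp_skip ⟨fr, z', y', L₄, hz', hy', hb', ?_,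
    Or.inl ?_⟩) (fun hle => wp_seq (wp_assign ?_ (wp_assign trivial
      ⟨(fr.update (by simp) _).update (by simp) _, z', y', L₄, hz', hy', hb', ?_, Or.inr ?_⟩)))
  · simp
    omega
  · simp only [Arith.val] at hlt
    obtain ⟨hf', hsys⟩ := h₄.resolve_right (by omega)
    exact ⟨fv₄, hlo, hf', hsys.exists_solution hI'⟩
  · simp [fv₄]
    omega
  · simp
    omega
  · simp only [Arith.val] at hle
    obtain ⟨hf', hno⟩ := h₄.resolve_left (by omega)
    refine ⟨by simp [fv₄], by simp [fv₄], fun ⟨a, ha⟩ => ?_⟩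
    obtain ⟨z'', h₁, h₂⟩ := ha.exists_diffSystem hI'
    exact hno z'' h₁ h₂

/-! ### Tightening a single lower bound -/

theorem oadSolution_updateU_iff {i v : ℕ} (hi : i < n) (hv : v ≤ u i) {a : ℕ → ℕ} :
    OadSolution n l (Function.update u i v) σ τ a ↔ OadSolution n l u σ τ a ∧ a i ≤ v := by
  constructor
  · intro h
    have h₁ := (h.1 i hi).2
    rw [Function.update_self] at h₁
    refine ⟨⟨fun j hj => ?_, h.2⟩, h₁⟩
    have := h.1 j hj
    simp only [Function.update_apply] at this
    split_ifs at this with e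
    · subst e
      omega
    · exact this
  · rintro ⟨h, hv'⟩
    refine ⟨fun j hj => ?_, h.2⟩
    have := h.1 j hj
    simp only [Function.update_apply]
    split_ifs with e
    · subst e
      omega
    · exact this

/-- The cost of tightening one bound. -/
def tightenCost (n d : ℕ) : ℕ :=
  (d + 1) * ((d + 1) * (600 * n + 250) + 30) + (d + 1) * 100 +
    closureCost d * ((d + 1) * (d + n + 2)) + (d + 1) * (lowerCost n d + 50) + 200

/-- The value sought is the smallest v for which the instance with upper bound v is solvable. The
potential of the zero labels, (d + 1)(d + n + 2), is paid once for all lowerings. If already the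
original upper bound fails, the loop ends with v above it, which is how unsolvability is recognised.
-/
theorem wp_tightenCmd (hB : 4 * n + 4 * d + (d + 1) * (d + 1) + 20 ≤ B)
    (hI : OadInstance n d l u σ τ) {i : ℕ} (hi : i < n) {s : St OadVar} (hn : s.var .n = n)
    (hd : s.var .d = d) (hsi : s.var .i = i) (L : Layout n d s.mem l u σ τ z y w) :
    wp B tightenCmd (fun s' => s'.time ≤ s.time + tightenCost n d ∧
      Frame [.res, .hi, .v, .lo, .fail, .b, .k, .x, .y, .j, .cC, .cA, .cB, .p, .q]
        s.var s'.var ∧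
      ∃ z' y' w', ((¬ ∃ a, OadSolution n l u σ τ a) ∧ s'.var .res = 0 ∧
          Layout n d s'.mem l u σ τ z' y' w') ∨
        (s'.var .res = s.var .res ∧ ∃ m, IsLeast {t | ∃ a, OadSolution n l u σ τ a ∧ a i = t} m ∧
          Layout n d s'.mem (Function.update l i m) u σ τ z' y' w')) s := by
  have hli := L.l i hi
  have hui := L.u i hi
  have := hI.le i hi
  have := hI.le_d i hi
  refine wp_seq (wp_assign ?_ (wp_seq (wp_assign ?_ (wp_seq (wp_assign ?_ (wp_seq
    (wp_assign ?_ (wp_seq ?_))))))))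
  · simp [cell, hsi]
    omega
  · simp [cell, hsi, hui]
    omega
  · simp [cell, hsi]
    omega
  · simp
  refine wp.mono (wp_buildCmd (z := z) (y := y) (w := w) hB hI (by simp [hn]) (by simp [hd])
    (by exact L)) ?_
  rintro s₁ - ⟨t₁, f₁, L₁⟩
  have fn₁ : s₁.var .n = n := (f₁ .n (by simp)).trans (by simp [hn])
  have fd₁ : s₁.var .d = d := (f₁ .d (by simp)).trans (by simp [hd])
  refine wp_seq (wp.mono (wp_initCmd hB fn₁ fd₁ L₁) ?_)
  rintro s₂ - ⟨t₂, f₂, L₂⟩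
  have fr : Frame [.hi, .v, .lo, .fail, .b, .k, .x, .y, .j, .cC, .cA, .cB, .p, .q]
      s.var s₂.var := by
    refine Frame.trans (Frame.trans (((((Frame.refl _ _).update ?_ _).update ?_ _).update
      ?_ _).update ?_ _) f₁ ?_) f₂ ?_ <;> simp
  have hv₂ : s₂.var .v = u i + 1 := (f₂ .v (by simp)).trans ((f₁ .v (by simp)).trans
    (by simp [cell, hsi, hui]))
  have hlo₂ : s₂.var .lo = l i := (f₂ .lo (by simp)).trans ((f₁ .lo (by simp)).trans
    (by simp [cell, hsi, hli]))
  have hhi₂ : s₂.var .hi = u i := (f₂ .hi (by simp)).trans ((f₁ .hi (by simp)).trans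
    (by simp [cell, hsi, hui]))
  have hf₂ : s₂.var .fail = 0 := (f₂ .fail (by simp)).trans ((f₁ .fail (by simp)).trans
    (by simp))
  simp [cell] at t₁
  refine wp_seq (wp.mono (wp_loop
    (s₂.time + closureCost d * slack n d 0 + (u i + 1 - l i) * (lowerCost n d + 50))
    (fun s' => Frame [.hi, .v, .lo, .fail, .b, .k, .x, .y, .j, .cC, .cA, .cB, .p, .q]
        s.var s'.var ∧ s'.var .hi = u i ∧
      ∃ c z' y' v, Layout n d s'.mem l (Function.update u i c) σ τ z' y'
          (oadWeight n l (Function.update u i c) σ τ) ∧ s'.var .v = v ∧ l i ≤ v ∧ v ≤ u i + 1 ∧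
        (v ≤ u i → ∃ a, OadSolution n l (Function.update u i v) σ τ a) ∧
        s'.time + closureCost d * slack n d y' + (v - s'.var .lo) * (lowerCost n d + 50) ≤
          s₂.time + closureCost d * slack n d 0 + (u i + 1 - l i) * (lowerCost n d + 50) ∧
        ((s'.var .lo = l i ∧ s'.var .fail = 0 ∧ (v ≤ u i → c = v) ∧ (v = u i + 1 → c = u i) ∧
          (∀ q ≤ d, z' q ≤ d + n) ∧ (∀ q ≤ d, y' q ≤ z' q + 1) ∧
          BelowSolutions d (oadWeight n l (Function.update u i c) σ τ) z') ∨
        (s'.var .lo = v ∧ ∃ v', v = v' + 1 ∧ l i ≤ v' ∧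
          ¬ ∃ a, OadSolution n l (Function.update u i v') σ τ a)))
    ?_ ?_ ?_ ?_) ?_)
  · rintro s' ⟨-, -, c, z', y', v, -, -, -, -, -, ht, -⟩
    omega
  · exact fun _ _ => ⟨trivial, trivial⟩
  · rintro s' ⟨hf', hhi', c, z', y', v, L', hv', hlv, hvu, hsol, ht, h'⟩ hlt
    simp only [Arith.val, hv'] at hlt
    obtain ⟨hlo', hfail', hc₁, hc₂, hz', hy', hb'⟩ := h'.resolve_right (by omega)
    obtain ⟨v, rfl⟩ : ∃ v', v = v' + 1 := ⟨v - 1, by omega⟩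
    have hc : c = v ∨ c = v + 1 := by omega
    refine wp.mono (wp_lowerCmd (s := ⟨s'.var, s'.mem, s'.time + (1 + 1 + 4)⟩) hB hI hi
      ((hf' .n (by simp)).trans hn)
      ((hf' .d (by simp)).trans hd) ((hf' .i (by simp)).trans hsi) hfail' hv' (by omega)
      (by omega) hc L' hz' hy' hb') ?_
    rintro s₃ - ⟨f₃, z₃, y₃, L₃, hz₃, hy₃, hb₃, t₃, h₃⟩
    simp only at t₃
    have e₁ : (v + 1 - l i) * (lowerCost n d + 50) =
        (v - l i) * (lowerCost n d + 50) + (lowerCost n d + 50) := by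
      rw [Nat.sub_add_comm (by omega)]
      ring
    rw [hlo', e₁] at ht
    refine ⟨hf'.trans f₃ (by simp), (f₃ .hi (by simp)).trans hhi', v, z₃, y₃, ?_⟩
    rcases h₃ with ⟨h₁, h₂, h₄, h₅⟩ | ⟨h₁, h₂, h₃⟩
    · refine ⟨v, L₃, h₁, by omega, by omega, fun _ => h₅, ?_, Or.inl ⟨h₂.trans hlo', h₄,
        fun _ => rfl, by omega, hz₃, hy₃, hb₃⟩⟩
      rw [h₂]
      simp only [hlo']
      omega
    · refine ⟨v + 1, L₃, h₁, by omega, by omega, hsol, ?_, Or.inr ⟨h₂, v, rfl, by omega, h₃⟩⟩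
      rw [h₂, Nat.sub_self, zero_mul]
      omega
  -- Initially v = u i + 1 has not been tested, and zero labels are below everything.
  · refine ⟨fr, hhi₂, u i, 0, 0, u i + 1, by simpa using L₂, hv₂, by omega, le_rfl, by omega,
      by rw [hlo₂], Or.inl ⟨hlo₂, hf₂, by omega, fun _ => rfl, by simp, by simp, ?_⟩⟩
    intro z' _ _ q _
    simp
  · rintro s' - ⟨s₀, ⟨hf₀, hhi₀, c, z', y', v, L₀, hv₀, hlv, hvu, hsol, ht, h₀⟩, hle, rfl⟩
    simp only [Arith.val, hv₀] at hle
    -- The loop ends either because v has reached the lower bound, leaving nothing below it, or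
    -- because v - 1 was refuted, which refutes all smaller values too.
    have hlow : ∀ v' < v, l i ≤ v' → ¬ ∃ a, OadSolution n l (Function.update u i v') σ τ a := by
      rcases h₀ with ⟨h₁, -⟩ | ⟨-, v₁, rfl, hlv₁, hno⟩
      · intros
        omega
      · rintro v' hv' _ ⟨a, ha⟩
        rw [oadSolution_updateU_iff hi (by omega)] at ha
        exact hno ⟨a, (oadSolution_updateU_iff hi (by omega)).2 ⟨ha.1, by omega⟩⟩
    have fi₀ := (hf₀ .i (by simp)).trans hsi
    have L₃ := L₀.setU hi (u i)
    rw [Function.update_idem, Function.update_eq_self] at L₃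
    have hslack : slack n d 0 = (d + 1) * (d + n + 2) := by simp [slack]
    have hmul : (u i + 1 - l i) * (lowerCost n d + 50) ≤ (d + 1) * (lowerCost n d + 50) :=
      Nat.mul_le_mul_right _ (by omega)
    rw [hslack] at ht
    have hcost : tightenCost n d = (d + 1) * ((d + 1) * (600 * n + 250) + 30) + (d + 1) * 100 +
      closureCost d * ((d + 1) * (d + n + 2)) + (d + 1) * (lowerCost n d + 50) + 200 := rfl
    refine wp_seq (wp_store ?_ trivial (wp_ite trivial trivial (fun hlt => wp_assign ?_
      ⟨?_, ?_, z', y', oadWeight n l (Function.update u i c) σ τ, Or.inl ⟨?_, ?_, ?_⟩⟩) (fun hle' => wp_store ?_ trivial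
      ⟨?_, ?_, z', y', oadWeight n l (Function.update u i c) σ τ, Or.inr ⟨?_, v, ⟨?_, ?_⟩, ?_⟩⟩)))
    · simp [cell, fi₀]
      omega
    · simp
    · simp [cell]
      omega
    · exact Frame.update (fun r hr => hf₀ r fun h => hr (List.mem_cons_of_mem _ h)) (by simp) _
    · rintro ⟨a, ha⟩
      simp only [Arith.val, hv₀, hhi₀] at hlt
      exact hlow (u i) hlt (by omega) ⟨a, by rwa [Function.update_eq_self]⟩
    · simp
    · simpa [cell, fi₀, hhi₀] using L₃
    · simp [cell, fi₀]
      omega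
    · simp [cell]
      omega
    · exact fun r hr => hf₀ r fun h => hr (List.mem_cons_of_mem _ h)
    · exact hf₀ .res (by simp)
    · simp only [Arith.val, hv₀, hhi₀] at hle'
      obtain ⟨a, ha⟩ := hsol hle'
      rw [oadSolution_updateU_iff hi hle'] at ha
      refine ⟨a, ha.1, ?_⟩
      by_contra hne
      have := (ha.1.1 i hi).1
      exact hlow (a i) (by omega) this
        ⟨a, (oadSolution_updateU_iff hi (by omega)).2 ⟨ha.1, le_rfl⟩⟩
    · rintro t ⟨a, ha, rfl⟩
      by_contra hlt
      have := ha.1 i hi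
      exact hlow (a i) (by omega) this.1
        ⟨a, (oadSolution_updateU_iff hi this.2).2 ⟨ha, le_rfl⟩⟩
    · have L₄ := L₃.setL hi v
      simpa [cell, fi₀, hhi₀, hv₀] using L₄

/-! ### Reflection and passes over all variables -/

theorem wp_reflectCmd (hB : 4 * n + 4 * d + (d + 1) * (d + 1) + 20 ≤ B)
    {s : St OadVar} (hn : s.var .n = n) (hd : s.var .d = d) (L : Layout n d s.mem l u σ τ z y w) :
    wp B reflectCmd (fun s' => s'.time ≤ s.time + n * 100 + 100 ∧ Frame [.i, .x] s.var s'.var ∧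
      Layout n d s'.mem (fun j => d + 1 - u j) (fun j => d + 1 - l j) σ τ z y w) s := by
  refine wp.mono (wp_forRange (m := n) (K := 80) (by omega) (by omega)
    (fun k f M => f .i = k ∧ Frame [.i, .x] s.var f ∧
      ∃ l' u', Layout n d M l' u' σ τ z y w ∧
        ∀ j, (j < k → l' j = d + 1 - u j ∧ u' j = d + 1 - l j) ∧
          (k ≤ j → l' j = l j ∧ u' j = u j)) ?_ ?_ ?_) ?_
  · rintro k f M ⟨hk, hf, -⟩
    exact ⟨hk, by simp [hf .n, hn], trivial⟩
  · rintro k hk s₁ ⟨hk₁, hf, l', u', L₁, h₁⟩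
    have fd := hf .d (by simp)
    rw [hd] at fd
    have hl := L₁.l k hk
    have hu := L₁.u k hk
    obtain ⟨hlk, huk⟩ := (h₁ k).2 le_rfl
    rw [hlk] at hl
    rw [huk] at hu
    have L₂ := (L₁.setL hk (d + 1 - u k)).setU hk (d + 1 - l k)
    refine wp_seq (wp_assign ?_ (wp_seq (wp_store ?_ ?_ (wp_store ?_ ?_ ⟨?_, ?_, ?_, ?_,
      Function.update l' k (d + 1 - u k), Function.update u' k (d + 1 - l k), ?_,
      fun j => ⟨fun hj => ?_, fun hj => ?_⟩⟩))))
    · simp [cell, hk₁]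
      omega
    · simp [cell, hk₁]
      omega
    · simp [cell, hk₁, numNodes, fd]
      omega
    · simp [cell, hk₁]
      omega
    · simp [numNodes, fd]
      omega
    · simp [cell, numNodes]
    · simp [hk₁]
    · simp
    · exact (hf.update (by simp) _).update (by simp) _
    · simpa [cell, hk₁, numNodes, fd, hl, hu] using L₂
    · simp only [Function.update_apply]
      rcases Nat.lt_succ_iff_lt_or_eq.1 hj with hj | rfl
      · simpa [hj.ne] using (h₁ j).1 hj
      · simp
    · simpa [Function.update_apply, (show j ≠ k by omega)] using (h₁ j).2 (by omega)
  · exact ⟨by simp, (Frame.refl _ _).update (by simp) _, l, u, L, fun j => by simp⟩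
  · rintro s' - ⟨⟨-, hf, l', u', L', h'⟩, ht⟩
    refine ⟨?_, hf, fun j hj => (L'.l j hj).trans ((h' j).1 hj).1,
      fun j hj => (L'.u j hj).trans ((h' j).1 hj).2, L'.σ, L'.τ, L'.z, L'.y, L'.w⟩
    simp only [Arith.cost] at ht
    omega

/-- `m j` is the least value of the variable `j` in a solution. -/
def LeastValues (n : ℕ) (l u σ τ m : ℕ → ℕ) : Prop :=
  ∀ j < n, IsLeast {t | ∃ a, OadSolution n l u σ τ a ∧ a j = t} (m j)

theorem LeastValues.bounds {m : ℕ → ℕ} (h : LeastValues n l u σ τ m) {j : ℕ} (hj : j < n) :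
    l j ≤ m j ∧ m j ≤ u j := by
  obtain ⟨a, ha, e⟩ := (h j hj).1
  exact e ▸ ha.1 j hj

/-- Raising lower bounds to least values removes no solution, so tightening one variable does not
affect the targets of the others. -/
theorem LeastValues.solution_iff {m l' : ℕ → ℕ} (h : LeastValues n l u σ τ m)
    (hl' : ∀ j < n, l' j = l j ∨ l' j = m j) {a : ℕ → ℕ} :
    OadSolution n l' u σ τ a ↔ OadSolution n l u σ τ a := by
  constructor
  · refine fun ha => ⟨fun j hj => ⟨?_, (ha.1 j hj).2⟩, ha.2⟩
    have h₁ := (ha.1 j hj).1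
    have h₂ := (h.bounds hj).1
    rcases hl' j hj with e | e <;> omega
  · refine fun ha => ⟨fun j hj => ⟨?_, (ha.1 j hj).2⟩, ha.2⟩
    have h₁ := (ha.1 j hj).1
    have h₂ := (h j hj).2 ⟨a, ha, rfl⟩
    rcases hl' j hj with e | e <;> omega

theorem exists_leastValues (h : ∃ a, OadSolution n l u σ τ a) :
    ∃ m, LeastValues n l u σ τ m := by
  obtain ⟨a, ha⟩ := h
  have : ∀ j, ∃ m, IsLeast {t | ∃ a, OadSolution n l u σ τ a ∧ a j = t} m := fun j =>
    ⟨_, Nat.sInf_mem ⟨a j, a, ha, rfl⟩, fun t ht => Nat.sInf_le ht⟩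
  choose m hm using this
  exact ⟨m, fun j _ => hm j⟩

theorem wp_tightenAll (hB : 4 * n + 4 * d + (d + 1) * (d + 1) + 20 ≤ B) (hn₀ : 0 < n)
    (hI : OadInstance n d l u σ τ) {s : St OadVar} (hn : s.var .n = n) (hd : s.var .d = d)
    (L : Layout n d s.mem l u σ τ z y w) :
    wp B (forRange .i (.var .n) tightenCmd) (fun s' =>
      s'.time ≤ s.time + n * (tightenCost n d + 20) + 20 ∧
      s'.var .n = n ∧ s'.var .d = d ∧
      ∃ z' y' w', ((¬ ∃ a, OadSolution n l u σ τ a) ∧ s'.var .res = 0 ∧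
          Layout n d s'.mem l u σ τ z' y' w') ∨
        (s'.var .res = s.var .res ∧ ∃ m, LeastValues n l u σ τ m ∧
          Layout n d s'.mem m u σ τ z' y' w')) s := by
  -- If a solution exists, all least values `m` are fixed in advance and survive the tightenings.
  -- Otherwise every tightening fails and keeps the bounds; since n > 0, at least one records the
  -- failure.
  by_cases hfeas : ∃ a, OadSolution n l u σ τ a
  · obtain ⟨m, hm⟩ := exists_leastValues hfeas
    refine wp.mono (wp_forRange (m := n) (K := tightenCost n d) (by omega) (by omega)
      (fun k f M => f .i = k ∧ f .n = n ∧ f .d = d ∧ f .res = s.var .res ∧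
        ∃ z' y' w' l', Layout n d M l' u σ τ z' y' w' ∧
          ∀ j, (j < k → l' j = m j) ∧ (k ≤ j → l' j = l j)) ?_ ?_ ?_) ?_
    · rintro k f M ⟨hk, hf, -⟩
      exact ⟨hk, by simp [hf], trivial⟩
    · rintro k hk s₁ ⟨hk₁, hn₁, hd₁, hr₁, z₁, y₁, w₁, l₁, L₁, h₁⟩
      have hl₁ : ∀ j < n, l₁ j = l j ∨ l₁ j = m j := fun j hj => by
        rcases lt_or_ge j k with hjk | hjk
        · exact Or.inr ((h₁ j).1 hjk)
        · exact Or.inl ((h₁ j).2 hjk)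
      have hb₁ : ∀ j < n, l j ≤ l₁ j ∧ l₁ j ≤ u j := fun j hj => by
        have := hm.bounds hj
        have := hI.le j hj
        rcases hl₁ j hj with e | e <;> omega
      have hI₁ : OadInstance n d l₁ u σ τ := ⟨fun j hj => (hI.one_le j hj).trans (hb₁ j hj).1,
        fun j hj => (hb₁ j hj).2, hI.le_d, hI.left_le, hI.right_le, hI.cover⟩
      refine wp.mono (wp_tightenCmd hB hI₁ hk hn₁ hd₁ hk₁ L₁) ?_
      rintro s₂ - ⟨t₂, f₂, z₂, y₂, w₂, h₂⟩
      have hi₂ := (f₂ .i (by simp)).trans hk₁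
      have hn₂ := (f₂ .n (by simp)).trans hn₁
      have hd₂ := (f₂ .d (by simp)).trans hd₁
      simp only [hm.solution_iff hl₁] at h₂
      obtain ⟨hr, m', hm', L₂⟩ := h₂.resolve_left fun h => h.1 hfeas
      refine ⟨t₂, hi₂, by simp, by simpa using hn₂, by simpa using hd₂,
        by simpa using hr.trans hr₁, z₂, y₂, w₂, _, L₂, fun j => ⟨fun hj => ?_, fun hj => ?_⟩⟩
      · rcases Nat.lt_succ_iff_lt_or_eq.1 hj with hj | rfl
        · rw [Function.update_of_ne hj.ne]
          exact (h₁ j).1 hj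
        · rw [Function.update_self]
          exact hm'.unique (hm j hk)
      · rw [Function.update_of_ne (by omega)]
        exact (h₁ j).2 (by omega)
    · exact ⟨by simp, by simp [hn], by simp [hd], by simp, z, y, w, l, L, by simp⟩
    · rintro s' - ⟨⟨-, hn', hd', hr', z', y', w', l', L', h'⟩, ht⟩
      simp only [Arith.cost] at ht
      have : n * (tightenCost n d + 1 + 10) ≤ n * (tightenCost n d + 20) :=
        Nat.mul_le_mul_left _ (by omega)
      exact ⟨by omega, hn', hd', z', y', w', Or.inr ⟨hr', m, hm,
        fun j hj => (L'.l j hj).trans ((h' j).1 hj), L'.u, L'.σ, L'.τ, L'.z, L'.y, L'.w⟩⟩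
  · refine wp.mono (wp_forRange (m := n) (K := tightenCost n d) (by omega) (by omega)
      (fun k f M => f .i = k ∧ f .n = n ∧ f .d = d ∧ (0 < k → f .res = 0) ∧
        ∃ z' y' w', Layout n d M l u σ τ z' y' w') ?_ ?_ ?_) ?_
    · rintro k f M ⟨hk, hf, -⟩
      exact ⟨hk, by simp [hf], trivial⟩
    · rintro k hk s₁ ⟨hk₁, hn₁, hd₁, -, z₁, y₁, w₁, L₁⟩
      refine wp.mono (wp_tightenCmd hB hI hk hn₁ hd₁ hk₁ L₁) ?_
      rintro s₂ - ⟨t₂, f₂, z₂, y₂, w₂, h₂⟩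
      have hi₂ := (f₂ .i (by simp)).trans hk₁
      have hn₂ := (f₂ .n (by simp)).trans hn₁
      have hd₂ := (f₂ .d (by simp)).trans hd₁
      obtain ⟨-, hr, L₂⟩ := h₂.resolve_right fun ⟨_, _, ⟨⟨a, ha, _⟩, _⟩, _⟩ => hfeas ⟨a, ha⟩
      exact ⟨t₂, hi₂, by simp, by simpa using hn₂, by simpa using hd₂,
        fun _ => by simpa using hr, z₂, y₂, w₂, L₂⟩
    · exact ⟨by simp, by simp [hn], by simp [hd], by simp, z, y, w, L⟩
    · rintro s' - ⟨⟨-, hn', hd', hr', z', y', w', L'⟩, ht⟩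
      simp only [Arith.cost] at ht
      have : n * (tightenCost n d + 1 + 10) ≤ n * (tightenCost n d + 20) :=
        Nat.mul_le_mul_left _ (by omega)
      exact ⟨by omega, hn', hd', z', y', w', Or.inl ⟨hfeas, hr' hn₀, L'⟩⟩

/-- The cost of one pass. -/
def passCost (n d : ℕ) : ℕ := n * (tightenCost n d + 20) + n * 100 + 200

theorem wp_passCmd (hB : 4 * n + 4 * d + (d + 1) * (d + 1) + 20 ≤ B) (hn₀ : 0 < n)
    (hI : OadInstance n d l u σ τ) {s : St OadVar} (hn : s.var .n = n) (hd : s.var .d = d)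
    (L : Layout n d s.mem l u σ τ z y w) :
    wp B passCmd (fun s' => s'.time ≤ s.time + passCost n d ∧ s'.var .n = n ∧ s'.var .d = d ∧
      ∃ z' y' w', ((¬ ∃ a, OadSolution n l u σ τ a) ∧ s'.var .res = 0 ∧
          Layout n d s'.mem (fun j => d + 1 - u j) (fun j => d + 1 - l j) σ τ z' y' w') ∨
        (s'.var .res = s.var .res ∧ ∃ m, LeastValues n l u σ τ m ∧
          Layout n d s'.mem (fun j => d + 1 - u j) (fun j => d + 1 - m j) σ τ z' y' w')) s := by
  refine wp_seq (wp.mono (wp_tightenAll hB hn₀ hI hn hd L) ?_)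
  rintro s₁ - ⟨t₁, hn₁, hd₁, z₁, y₁, w₁, h₁⟩
  have hc : passCost n d = n * (tightenCost n d + 20) + n * 100 + 200 := rfl
  rcases h₁ with ⟨hno, hr, L₁⟩ | ⟨hr, m, hm, L₁⟩
  · refine wp.mono (wp_reflectCmd hB hn₁ hd₁ L₁) ?_
    rintro s₂ - ⟨t₂, f₂, L₂⟩
    exact ⟨by omega, (f₂ .n (by simp)).trans hn₁, (f₂ .d (by simp)).trans hd₁, z₁, y₁, w₁,
      Or.inl ⟨hno, (f₂ .res (by simp)).trans hr, L₂⟩⟩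
  · refine wp.mono (wp_reflectCmd hB hn₁ hd₁ L₁) ?_
    rintro s₂ - ⟨t₂, f₂, L₂⟩
    exact ⟨by omega, (f₂ .n (by simp)).trans hn₁, (f₂ .d (by simp)).trans hd₁, z₁, y₁, w₁,
      Or.inr ⟨(f₂ .res (by simp)).trans hr, m, hm, L₂⟩⟩

theorem _root_.OadInstance.reflect (h : OadInstance n d l u σ τ) :
    OadInstance n d (fun j => d + 1 - u j) (fun j => d + 1 - l j) σ τ := by
  refine ⟨fun j hj => ?_, fun j hj => ?_, fun j hj => ?_, h.left_le, h.right_le, h.cover⟩ <;>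
  · have := h.one_le j hj
    have := h.le j hj
    have := h.le_d j hj
    omega

theorem _root_.OadSolution.reflect {a : ℕ → ℕ} (h : OadSolution n l u σ τ a)
    (hI : OadInstance n d l u σ τ) :
    OadSolution n (fun j => d + 1 - u j) (fun j => d + 1 - l j) σ τ (fun j => d + 1 - a j) := by
  refine ⟨fun j hj => ?_, fun j hj k hk hjk he => h.2 j hj k hk hjk ?_⟩
  · have := h.1 j hj
    simp only
    omega
  · have := h.1 j hj
    have := h.1 k hk
    have := hI.le_d j hj
    have := hI.le_d k hk
    simp only at he
    omega

theorem _root_.OadSolution.of_reflect {a : ℕ → ℕ} (hI : OadInstance n d l u σ τ)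
    (h : OadSolution n (fun j => d + 1 - u j) (fun j => d + 1 - l j) σ τ a) :
    OadSolution n l u σ τ (fun j => d + 1 - a j) := by
  refine ⟨fun j hj => ?_, fun j hj k hk hjk he => h.2 j hj k hk hjk ?_⟩
  · obtain ⟨h₁, h₂⟩ : d + 1 - u j ≤ a j ∧ a j ≤ d + 1 - l j := h.1 j hj
    have := hI.le_d j hj
    have := hI.le j hj
    simp only
    omega
  · obtain ⟨-, hj'⟩ : _ ∧ a j ≤ d + 1 - l j := h.1 j hj
    obtain ⟨-, hk'⟩ : _ ∧ a k ≤ d + 1 - l k := h.1 k hk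
    have := hI.one_le j hj
    have := hI.one_le k hk
    simp only at he
    omega

/-- Each of S and T takes distinct values in {1, …, d}, and together they cover all variables. This
allows n to be replaced by O(d) in the cost of one variable. -/
theorem _root_.OadSolution.le_two_mul {a : ℕ → ℕ} (h : OadSolution n l u σ τ a)
    (hI : OadInstance n d l u σ τ) : n ≤ d + d := by
  have key : ∀ e : ℕ → ℕ, (∀ j < n, ∀ k < n, j ≠ k → a j = a k → ¬ (e j = 1 ∧ e k = 1)) →
      ((Finset.range n).filter fun j => e j = 1).card ≤ d := by
    intro e he
    have : ((Finset.range n).filter fun j => e j = 1).card ≤ (Finset.Icc 1 d).card := by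
      refine Finset.card_le_card_of_injOn a (fun j hj => ?_) fun j hj k hk hjk => ?_
      · simp only [Finset.mem_coe, Finset.mem_filter, Finset.mem_range] at hj
        have := h.1 j hj.1
        have := hI.one_le j hj.1
        have := hI.le_d j hj.1
        simp only [Finset.coe_Icc, Set.mem_Icc]
        omega
      · simp only [Finset.mem_coe, Finset.mem_filter, Finset.mem_range] at hj hk
        by_contra hne
        exact he j hj.1 k hk.1 hne hjk ⟨hj.2, hk.2⟩
    simpa using this
  have h₁ := key σ fun j hj k hk hjk he => (h.2 j hj k hk hjk he).1
  have h₂ := key τ fun j hj k hk hjk he => (h.2 j hj k hk hjk he).2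
  have h₃ : Finset.range n ⊆ ((Finset.range n).filter fun j => σ j = 1) ∪
      ((Finset.range n).filter fun j => τ j = 1) := fun j hj => by
    simp only [Finset.mem_union, Finset.mem_filter]
    have hj' := Finset.mem_range.1 hj
    have := hI.left_le j hj'
    have := hI.right_le j hj'
    have := hI.cover j hj'
    rcases (show σ j = 1 ∨ τ j = 1 by omega) with e | e
    · exact Or.inl ⟨hj, e⟩
    · exact Or.inr ⟨hj, e⟩
  have h₄ := (Finset.card_le_card h₃).trans (Finset.card_union_le _ _)
  rw [Finset.card_range] at h₄
  omega

theorem passCost_le (hn : 0 < n) (hd : 0 < d) (hnd : n ≤ d + d) :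
    passCost n d ≤ 27000 * (n * d ^ 3) := by
  have hd2 : d ≤ d ^ 2 := Nat.le_self_pow (by norm_num) d
  have hd3 : d ^ 2 ≤ d ^ 3 := Nat.pow_le_pow_right hd (by norm_num)
  have h₁ : 600 * n + 250 ≤ 1450 * d := by omega
  have h₂ : d + 1 ≤ 2 * d := by omega
  have h₃ : (d + 1) * (600 * n + 250) ≤ 2900 * d ^ 2 :=
    (Nat.mul_le_mul h₂ h₁).trans_eq (by ring)
  have h₃' : (d + 1) * (600 * n + 250) + 30 ≤ 2930 * d ^ 2 := by linarith
  have h₄ : (d + 1) * ((d + 1) * (600 * n + 250) + 30) ≤ 5860 * d ^ 3 :=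
    (Nat.mul_le_mul h₂ h₃').trans_eq (by ring)
  have h₅ : closureCost d ≤ 800 * d := by unfold closureCost; linarith
  have h₆ : (d + 1) * (d + n + 2) ≤ 10 * d ^ 2 :=
    (Nat.mul_le_mul h₂ (show d + n + 2 ≤ 5 * d by omega)).trans_eq (by ring)
  have h₇ : closureCost d * ((d + 1) * (d + n + 2)) ≤ 8000 * d ^ 3 :=
    (Nat.mul_le_mul h₅ h₆).trans_eq (by ring)
  have h₈ : closureCost d * (d + 2) ≤ 2400 * d ^ 2 :=
    (Nat.mul_le_mul h₅ (show d + 2 ≤ 3 * d by omega)).trans_eq (by ring)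
  have h₉ : lowerCost n d + 50 ≤ 5750 * d ^ 2 := by rw [lowerCost]; omega
  have h₁₀ : (d + 1) * (lowerCost n d + 50) ≤ 11500 * d ^ 3 :=
    (Nat.mul_le_mul h₂ h₉).trans_eq (by ring)
  have h₁₁ : tightenCost n d + 20 ≤ 25800 * d ^ 3 := by rw [tightenCost]; omega
  have h₁₂ : n * (tightenCost n d + 20) ≤ 25800 * (n * d ^ 3) :=
    (Nat.mul_le_mul_left n h₁₁).trans_eq (by ring)
  have h₁₃ : n * 1 ≤ n * d ^ 3 := Nat.mul_le_mul_left n (by omega)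
  rw [passCost]
  omega

/-- The result of the whole computation. -/
theorem wp_oadCmd (hB : 4 * n + 4 * d + (d + 1) * (d + 1) + 20 ≤ B) (hn₀ : 0 < n)
    (hI : OadInstance n d l u σ τ) {s : St OadVar} (hn : s.mem 0 = n) (hd : s.mem 1 = d)
    (hres : s.var .res = 0) (L : Layout n d s.mem l u σ τ z y w) :
    wp B oadCmd (fun s' => s'.time ≤ s.time + 60000 * (n * d ^ 3) ∧
      ((s'.var .res = 0 ∧ ¬ ∃ a, OadSolution n l u σ τ a) ∨
        (s'.var .res = 1 ∧ ∀ j < n,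
          IsLeast {t | ∃ a, OadSolution n l u σ τ a ∧ a j = t} (s'.mem (4 * j + 2)) ∧
          IsGreatest {t | ∃ a, OadSolution n l u σ τ a ∧ a j = t} (s'.mem (4 * j + 3))))) s := by
  have hd₀ : 0 < d := by
    have := hI.one_le 0 hn₀
    have := hI.le 0 hn₀
    have := hI.le_d 0 hn₀
    omega
  have hpos : 0 < n * d ^ 3 := by positivity
  refine wp_seq (wp_assign (by simp) (wp_seq (wp_assign (by simp; omega) (wp_ite ?_ trivial
    (fun hlt => wp_skip ⟨?_, Or.inl ⟨by simpa using hres, ?_⟩⟩)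
    (fun hle => wp_seq (wp_assign (by simp; omega) (wp_seq ?_)))))))
  · simp [hd]
    omega
  · simp
    omega
  · rintro ⟨a, ha⟩
    simp [hn, hd] at hlt
    exact absurd (ha.le_two_mul hI) (by omega)
  simp [hn, hd] at hle
  have hcost := passCost_le hn₀ hd₀ hle
  refine wp.mono (wp_passCmd (z := z) (y := y) (w := w) hB hn₀ hI (by simp [hn]) (by simp [hd])
    (by exact L)) ?_
  rintro s₁ - ⟨t₁, hn₁, hd₁, z₁, y₁, w₁, h₁⟩
  simp at t₁
  rcases h₁ with ⟨hno, hr, L₁⟩ | ⟨hr, m, hm, L₁⟩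
  · refine wp.mono (wp_passCmd hB hn₀ hI.reflect hn₁ hd₁ L₁) ?_
    rintro s₂ - ⟨t₂, -, -, z₂, y₂, w₂, h₂⟩
    refine ⟨by omega, Or.inl ⟨?_, hno⟩⟩
    -- After a failed first pass, the second one either records failure again or leaves the flag 0
    -- untouched.
    rcases h₂ with ⟨-, h, -⟩ | ⟨h, -⟩
    · exact h
    · exact h.trans hr
  · have hI₁ : OadInstance n d m u σ τ := ⟨fun j hj => (hI.one_le j hj).trans (hm.bounds hj).1,
      fun j hj => (hm.bounds hj).2, hI.le_d, hI.left_le, hI.right_le, hI.cover⟩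
    have hsol : ∀ a, OadSolution n m u σ τ a ↔ OadSolution n l u σ τ a := fun a =>
      hm.solution_iff fun j _ => Or.inr rfl
    refine wp.mono (wp_passCmd hB hn₀ hI₁.reflect hn₁ hd₁ L₁) ?_
    rintro s₂ - ⟨t₂, -, -, z₂, y₂, w₂, h₂⟩
    refine ⟨by omega, Or.inr ?_⟩
    rcases h₂ with ⟨hno, -⟩ | ⟨hr₂, m', hm', L₂⟩
    · obtain ⟨a, ha, -⟩ := (hm 0 hn₀).1
      exact absurd ⟨_, ((hsol a).2 ha).reflect hI₁⟩ hno
    refine ⟨hr₂.trans (hr.trans (by simp)), fun j hj => ⟨?_, ?_, ?_⟩⟩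
    · have := hm.bounds hj
      have := hI.le_d j hj
      rw [L₂.l j hj, show d + 1 - (d + 1 - m j) = m j by omega]
      exact hm j hj
    -- The second pass reflects again at its end, so the stored upper bound is d + 1 minus the least
    -- reflected value, which is the greatest original value.
    · obtain ⟨a, ha, e⟩ := (hm' j hj).1
      exact ⟨_, (hsol _).1 (ha.of_reflect hI₁), by rw [L₂.u j hj, ← e]⟩
    · rintro t ⟨a, ha, rfl⟩
      have := (hm' j hj).2 ⟨_, ((hsol a).2 ha).reflect hI₁, rfl⟩
      have := ha.1 j hj
      have := hI.le_d j hj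
      rw [L₂.u j hj]
      omega

end WordRAM

/-! ### Bound consistency from extreme values of solutions -/

/-- Every solution lies within the new intervals, so the solutions attaining the ends are the
required supports. Conversely, bound supports in a subdomain `E` are solutions of the original
instance, so the minimum and maximum of `E` lie between the extreme values. -/
theorem isGreatest_bcSubdomains {X : Type*} {C : CSPConstraint X} {lb ub lo hi : X → ℕ}
    (hlo : ∀ x, IsLeast {t | ∃ a, (C a ∧ ∀ x, lb x ≤ a x ∧ a x ≤ ub x) ∧ a x = t} (lo x))
    (hhi : ∀ x, IsGreatest {t | ∃ a, (C a ∧ ∀ x, lb x ≤ a x ∧ a x ≤ ub x) ∧ a x = t} (hi x)) :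
    IsGreatest (bcSubdomains C fun x => Finset.Icc (lb x) (ub x))
      (fun x => Finset.Icc (lo x) (hi x)) := by
  have hle : ∀ x, lo x ≤ hi x := fun x => (hlo x).2 (hhi x).1
  have hsupp : ∀ a, C a → (∀ x, lb x ≤ a x ∧ a x ≤ ub x) →
      IsBoundSupport C (fun x => Finset.Icc (lo x) (hi x)) a := fun a ha hb => by
    refine ⟨ha, fun x => ⟨a x, ?_, a x, ?_, le_rfl, le_rfl⟩⟩ <;>
    exact Finset.mem_Icc.2 ⟨(hlo x).2 ⟨a, ⟨ha, hb⟩, rfl⟩, (hhi x).2 ⟨a, ⟨ha, hb⟩, rfl⟩⟩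
  refine ⟨⟨fun x => Finset.Icc_subset_Icc ?_ ?_, fun x => Finset.nonempty_Icc.2 (hle x), ?_⟩, ?_⟩
  · obtain ⟨a, ha, e⟩ := (hlo x).1
    exact e ▸ (ha.2 x).1
  · obtain ⟨a, ha, e⟩ := (hhi x).1
    exact e ▸ (ha.2 x).2
  · rintro x v (hv | hv)
    · rw [Finset.coe_Icc] at hv
      obtain ⟨a, ha, e⟩ := (hlo x).1
      exact ⟨a, hsupp a ha.1 ha.2, e.trans ((isLeast_Icc (hle x)).unique hv)⟩
    · rw [Finset.coe_Icc] at hv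
      obtain ⟨a, ha, e⟩ := (hhi x).1
      exact ⟨a, hsupp a ha.1 ha.2, e.trans ((isGreatest_Icc (hle x)).unique hv)⟩
  · rintro E ⟨hED, hne, hE⟩ x v hv
    have hsol : ∀ a, IsBoundSupport C E a → ∀ x, lb x ≤ a x ∧ a x ≤ ub x := fun a ha x => by
      obtain ⟨p, hp, q, hq, h₁, h₂⟩ := ha.2 x
      have h₃ := Finset.mem_Icc.1 (hED x hp)
      have h₄ := Finset.mem_Icc.1 (hED x hq)
      exact ⟨h₃.1.trans h₁, h₂.trans h₄.2⟩
    obtain ⟨a, ha, e⟩ := hE x _ (Or.inl ((E x).isLeast_min' (hne x)))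
    obtain ⟨a', hb, e'⟩ := hE x _ (Or.inr ((E x).isGreatest_max' (hne x)))
    refine Finset.mem_Icc.2 ⟨?_, ?_⟩
    · refine ((hlo x).2 ⟨a, ⟨ha.1, hsol a ha⟩, rfl⟩).trans ?_
      rw [e]
      exact (E x).min'_le v hv
    · refine le_trans ?_ ((hhi x).2 ⟨a', ⟨hb.1, hsol a' hb⟩, rfl⟩)
      rw [e']
      exact (E x).le_max' v hv

/-- A support for any one bound is already a solution. Some variable is needed: without variables
bound consistency holds vacuously, even for an unsatisfiable constraint. -/
theorem bcSubdomains_eq_empty {X : Type*} [Nonempty X] {C : CSPConstraint X} {lb ub : X → ℕ}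
    (h : ¬ ∃ a, C a ∧ ∀ x, lb x ≤ a x ∧ a x ≤ ub x) :
    bcSubdomains C (fun x => Finset.Icc (lb x) (ub x)) = ∅ := by
  refine Set.eq_empty_of_forall_notMem fun E ⟨hED, hne, hE⟩ => h ?_
  obtain ⟨x⟩ := ‹Nonempty X›
  obtain ⟨a, ha, -⟩ := hE x _ (Or.inl ((E x).isLeast_min' (hne x)))
  refine ⟨a, ha.1, fun x => ?_⟩
  obtain ⟨p, hp, q, hq, h₁, h₂⟩ := ha.2 x
  have h₃ := Finset.mem_Icc.1 (hED x hp)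
  have h₄ := Finset.mem_Icc.1 (hED x hq)
  exact ⟨h₃.1.trans h₁, h₂.trans h₄.2⟩

/-! ### Transfer from `Fin n` and the final assembly -/

/-- Extension of a function on `Fin n` by `0`. -/
def extendFin {n : ℕ} (f : Fin n → ℕ) (j : ℕ) : ℕ := if h : j < n then f ⟨j, h⟩ else 0

theorem extendFin_of_lt {n : ℕ} (f : Fin n → ℕ) {j : ℕ} (h : j < n) :
    extendFin f j = f ⟨j, h⟩ := dif_pos h

/-- The membership bit. -/
def memBit {n : ℕ} (S : Finset (Fin n)) (i : Fin n) : ℕ := if i ∈ S then 1 else 0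

theorem memBit_eq_one {n : ℕ} {S : Finset (Fin n)} {i : Fin n} : memBit S i = 1 ↔ i ∈ S := by
  simp [memBit]

theorem memBit_le {n : ℕ} (S : Finset (Fin n)) (i : Fin n) : memBit S i ≤ 1 := by
  unfold memBit
  split_ifs <;> simp

section

variable {n d : ℕ} {S T : Finset (Fin n)} {lb ub : Fin n → ℕ}

theorem oadInstance_extendFin (hST : S ∪ T = Finset.univ)
    (h : ∀ i, 1 ≤ lb i ∧ lb i ≤ ub i ∧ ub i ≤ d) :
    OadInstance n d (extendFin lb) (extendFin ub) (extendFin (memBit S))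
      (extendFin (memBit T)) := by
  constructor <;> intro j hj <;> simp only [extendFin_of_lt _ hj]
  · exact (h _).1
  · exact (h _).2.1
  · exact (h _).2.2
  · exact memBit_le S _
  · exact memBit_le T _
  · have hm : (⟨j, hj⟩ : Fin n) ∈ S ∪ T := hST ▸ Finset.mem_univ _
    rcases Finset.mem_union.1 hm with h' | h' <;> rw [memBit_eq_one.2 h'] <;> omega

theorem oadSolution_iff {a : ℕ → ℕ} :
    OadSolution n (extendFin lb) (extendFin ub) (extendFin (memBit S)) (extendFin (memBit T)) a ↔
      OverlappingAllDiff S T (fun i : Fin n => a i) ∧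
        ∀ i : Fin n, lb i ≤ a i ∧ a i ≤ ub i := by
  constructor
  · rintro ⟨h₁, h₂⟩
    refine ⟨⟨fun x hx y hy hxy e => ?_, fun x hx y hy hxy e => ?_⟩, fun i => ?_⟩
    · refine (h₂ x x.2 y y.2 (Fin.val_ne_of_ne hxy) e).1 ?_
      simp [extendFin_of_lt _ x.2, extendFin_of_lt _ y.2, memBit_eq_one, hx, hy]
    · refine (h₂ x x.2 y y.2 (Fin.val_ne_of_ne hxy) e).2 ?_
      simp [extendFin_of_lt _ x.2, extendFin_of_lt _ y.2, memBit_eq_one, hx, hy]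
    · simpa [extendFin_of_lt _ i.2] using h₁ i i.2
  · rintro ⟨⟨h₁, h₂⟩, h₃⟩
    refine ⟨fun j hj => ?_, fun j hj k hk hjk e => ?_⟩
    · simpa [extendFin_of_lt _ hj] using h₃ ⟨j, hj⟩
    · simp only [extendFin_of_lt _ hj, extendFin_of_lt _ hk, memBit_eq_one]
      exact ⟨fun h => h₁ _ h.1 _ h.2 (by simpa using hjk) e,
        fun h => h₂ _ h.1 _ h.2 (by simpa using hjk) e⟩

theorem layout_oadInputMemory : WordRAM.Layout n d (oadInputMemory d S T lb ub) (extendFin lb)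
    (extendFin ub) (extendFin (memBit S)) (extendFin (memBit T))
    (fun q => oadInputMemory d S T lb ub (4 * n + 2 + q))
    (fun q => oadInputMemory d S T lb ub (4 * n + 2 + (d + 1 + q)))
    (fun p q => oadInputMemory d S T lb ub (4 * n + 2 + ((d + 1) * 2 + (p * (d + 1) + q)))) := by
  constructor
  case z | y | w => intros; rfl
  all_goals
    intro j hj
    simp only [extendFin_of_lt _ hj, oadInputMemory, memBit]
  · simp [hj]
  · have h₁ : (4 * j + 1) / 4 = j := by omega
    have h₂ : (4 * j + 1) % 4 = 1 := by omega
    simp [h₁, h₂, hj]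
  · have h₁ : (4 * j + 2) / 4 = j := by omega
    have h₂ : (4 * j + 2) % 4 = 2 := by omega
    simp [h₁, h₂, hj]
  · have h₁ : (4 * j + 3) / 4 = j := by omega
    have h₂ : (4 * j + 3) % 4 = 3 := by omega
    simp [h₁, h₂, hj]

theorem oadInputMemory_le (h : ∀ i, 1 ≤ lb i ∧ lb i ≤ ub i ∧ ub i ≤ d) {B : ℕ} (hB : n + d ≤ B)
    (hB₁ : 1 ≤ B) (k : ℕ) : oadInputMemory d S T lb ub k ≤ B := by
  unfold oadInputMemory
  split_ifs with _ _ hk <;> try omega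
  all_goals
    have := h ⟨(k - 2) / 4, hk⟩
    omega

end

theorem WordRAM.OadVar.ctorIdx_injective : Function.Injective WordRAM.OadVar.ctorIdx := by
  intro r r' h
  rw [← WordRAM.OadVar.ofNat_ctorIdx r, h, WordRAM.OadVar.ofNat_ctorIdx]

open WordRAM in
theorem mainTheorem1 :
    ∃ (P : WordRAM.Program) (c : ℕ),
      ∀ (n d : ℕ) (S T : Finset (Fin n)) (lb ub : Fin n → ℕ),
        0 < n → S ∪ T = Finset.univ → (∀ i, 1 ≤ lb i ∧ lb i ≤ ub i ∧ ub i ≤ d) →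
          ∃ t : ℕ, t ≤ c * (n * d ^ 3) ∧
            WordRAM.Halted P (WordRAM.run P t (oadInput d S T lb ub)) ∧
            (∀ s ≤ t, (WordRAM.run P s (oadInput d S T lb ub)).WordsLE ((n + d) ^ c)) ∧
            HoldsBCResult (OverlappingAllDiff S T) (fun i => Finset.Icc (lb i) (ub i))
              (WordRAM.run P t (oadInput d S T lb ub)) := by
  -- The time factor of `wp_oadCmd` serves also as the exponent of the word bound, for which any
  -- exponent from 7 on would do, as n + d ≥ 2.
  obtain ⟨c, hc⟩ : ∃ c, c = 60000 := ⟨_, rfl⟩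
  refine ⟨oadCmd.code OadVar.ctorIdx 0, c, fun n d S T lb ub hn hST h => ?_⟩
  have hI := oadInstance_extendFin hST h
  have hd : 0 < d := (h ⟨0, hn⟩).1.trans ((h ⟨0, hn⟩).2.1.trans (h ⟨0, hn⟩).2.2)
  have hB : 4 * n + 4 * d + (d + 1) * (d + 1) + 20 ≤ (n + d) ^ c := by
    obtain ⟨x, hx⟩ : ∃ x, x = n + d := ⟨_, rfl⟩
    have hx2 : 2 ≤ x := by omega
    have h₁ : (d + 1) * (d + 1) ≤ x ^ 2 := by
      rw [sq]
      exact Nat.mul_le_mul (by omega) (by omega)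
    have h₂ : 2 * 2 * 2 * x ≤ x * x * x * x := by gcongr
    have h₃ : 2 * 2 * 2 * 2 * 2 * x ^ 2 ≤ x * x * x * x * x * x ^ 2 := by gcongr
    have h₄ : x ^ 7 ≤ x ^ c := Nat.pow_le_pow_right (by omega) (by omega)
    have h₅ : 2 * x ≤ x ^ 2 := by
      rw [sq]
      exact Nat.mul_le_mul_right x hx2
    have h₆ : x * x * x * x * x * x ^ 2 = x ^ 7 := by ring
    rw [← hx]
    omega
  obtain ⟨s', hexec, ht, hres⟩ := wp_oadCmd (s := ⟨fun _ => 0, oadInputMemory d S T lb ub, 0⟩)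
    hB hn hI (by simp [oadInputMemory]) (by simp [oadInputMemory]) rfl layout_oadInputMemory
  have hsim : Sim OadVar.ctorIdx ((n + d) ^ c) 0 (fun _ => 0) (oadInputMemory d S T lb ub)
      (oadInput d S T lb ub) := ⟨rfl, fun _ => rfl, rfl, fun k =>
    ⟨Nat.zero_le _, oadInputMemory_le h (by omega) (by omega) k⟩⟩
  obtain ⟨g, t, e, ⟨hg, hw⟩, hs⟩ := hexec.reaches OadVar.ctorIdx_injective (by omega)
    (P := oadCmd.code OadVar.ctorIdx 0) (k := 0) (fun i _ => by rw [zero_add]) hsim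
  simp only [zero_add] at e ht
  refine ⟨t, by rw [hc, ← e]; exact ht, ?_, hw, ?_⟩
  · rw [hg, Halted, hs.pc, Cmd.length_code, zero_add]
  rw [hg]
  -- Variable x sits in register `2 * ctorIdx x`, and `res` is the first constructor, hence register
  -- 0.
  have hr : g.reg 0 = s'.var .res := hs.var .res
  have : Nonempty (Fin n) := ⟨⟨0, hn⟩⟩
  have hset : ∀ x : Fin n, {t | ∃ a, OadSolution n (extendFin lb) (extendFin ub)
      (extendFin (memBit S)) (extendFin (memBit T)) a ∧ a x = t} =
      {t | ∃ a, (OverlappingAllDiff S T a ∧ ∀ x, lb x ≤ a x ∧ a x ≤ ub x) ∧ a x = t} := by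
    intro x
    ext t
    constructor
    · rintro ⟨a, ha, e⟩
      exact ⟨_, oadSolution_iff.1 ha, e⟩
    · rintro ⟨a, ha, e⟩
      refine ⟨extendFin a, oadSolution_iff.2 ?_, by rw [extendFin_of_lt _ x.2]; exact e⟩
      simpa [extendFin] using ha
  rcases hres with ⟨h₀, hno⟩ | ⟨h₁, hopt⟩
  · refine Or.inr ⟨hr.trans h₀, bcSubdomains_eq_empty ?_⟩
    rintro ⟨a, ha⟩
    refine hno ⟨extendFin a, oadSolution_iff.2 ?_⟩
    simpa [extendFin] using ha
  · refine Or.inl ⟨hr.trans h₁, isGreatest_bcSubdomains (fun x => ?_) fun x => ?_⟩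
    · rw [hs.mem, ← hset]
      exact (hopt x x.2).1
    · rw [hs.mem, ← hset]
      exact (hopt x x.2).2
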